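/- Let $\mathbb K$ be an algebraically closed field of characteristic zero. Let $f\in\mathbb K[x_0,\dots,x_N]$ be a homogeneous polynomial with vanishing hessian, $X=V(f)\subset\mathbb P^N$, let $\Phi_X:\mathbb P^N\dashrightarrow(\mathbb P^N)^*$ be its polar map $p\mapsto(\frac{\partial f}{\partial x_0}(p):\dots:\frac{\partial f}{\partial x_N}(p))$, let $Z=\overline{\Phi_X(\mathbb P^N)}$, and let $Z^*=\overline{\bigcup_{z\in Z_{\mathrm{reg}}}(T_zZ)^*}\subset\mathbb P^N$ be the dual variety of $Z$. The Perazzo map of $X$ is $p\mapsto (T_{\Phi_X(p)}Z)^*\in\mathbb G(\operatorname{codim}(Z)-1,N)$, defined where $\Phi_X(p)\in Z_{\mathrm{reg}}$; let $\mu$ be the dimension of the closure of its image. $X$ is called a Special Perazzo Cubic Hypersurface if $f$ is an irreducible cubic form with vanishing hessian, $X$ is not a cone, and the closures of the general fibers of the Perazzo map are linear spaces $\mathbb P^{N-\mu}$ which all contain one fixed $\mathbb P^{N-\mu-1}$. Theorem. Let $X=V(f)\subset\mathbb P^N$ be a Special Perazzo Cubic Hypersurface with $\operatorname{codim}(Z)=1$,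 put $\sigma=\dim(Z^*)+1$, suppose $2\sigma\le N$ and suppose that $$f=\sum_{j=0}^{\sigma}x_jC^j(x_{N-\sigma+1},\dots,x_N)+D(x_{\sigma+1},\dots,x_N)$$ with quadratic forms $C^j$ and a cubic form $D$. Let $A$ be the $\sigma\times\sigma$ matrix $$A=\Big[\sum_{j=0}^{\sigma}\frac{\partial^2C^j}{\partial x_k\,\partial x_i}\,x_j\Big]_{k,i\in\{N-\sigma+1,\dots,N\}}.$$ Then the entries of $A$ are linear forms in $x_0,\dots,x_\sigma$, $\det A\neq0$, and $Z^*$ is an irreducible component of the determinantal hypersurface $V(\det A,x_{\sigma+1},\dots,x_N)$ of $M=V(x_{\sigma+1},\dots,x_N)=\mathbb P^{\sigma}$. In particular $\deg(Z^*)\le\sigma=\dim(Z^*)+1$. -/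

import Mathlib

namespace Perazzo

open MvPolynomial

noncomputable section

/-! ### Projective spaces, their Zariski topology, dimension, degree -/

section Projective

variable {K ι : Type*} [Field K]

/-- `F` vanishes at the point `p` of the projective space `ℙ(K^ι)`, that is, on all of the
line of `K^ι` that `p` stands for. -/
def VanishesAt (F : MvPolynomial ι K) (p : Projectivization K (ι → K)) : Prop :=
  ∀ v ∈ p.submodule, eval v F = 0

/-- The projective zero locus `V(S)`. -/
def zeroLocus (S : Set (MvPolynomial ι K)) : Set (Projectivization K (ι → K)) :=
  {p | ∀ F ∈ S, VanishesAt F p}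

theorem vanishesAt_iff {F : MvPolynomial ι K} {d : ℕ} (hF : F.IsHomogeneous d)
    {p : Projectivization K (ι → K)} : VanishesAt F p ↔ eval p.rep F = 0 := by
  have hmem : p.rep ∈ p.submodule := by
    rw [p.submodule_eq]; exact Submodule.mem_span_singleton_self _
  refine ⟨fun h => h _ hmem, fun h v hv => ?_⟩
  rw [p.submodule_eq] at hv
  obtain ⟨c, rfl⟩ := Submodule.mem_span_singleton.1 hv
  have h1 : eval (c • p.rep) F = c ^ d * eval p.rep F := by
    rw [eval_eq, eval_eq, Finset.mul_sum]
    refine Finset.sum_congr rfl fun m hm => ?_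
    have hd : ∑ i ∈ m.support, m i = d := by
      have := hF (mem_support_iff.1 hm)
      rw [← this, Finsupp.weight_apply, Finsupp.sum]
      simp
    simp only [Pi.smul_apply, smul_eq_mul, mul_pow, Finset.prod_mul_distrib]
    rw [Finset.prod_pow_eq_pow_sum, hd]
    ring
  rw [h1, h, mul_zero]

/-- The Zariski topology on `ℙ(K^ι)`: the closed sets are the zero loci of sets of homogeneous
polynomials. -/
instance zariskiTopology : TopologicalSpace (Projectivization K (ι → K)) :=
  TopologicalSpace.ofClosed
    {V | ∃ S : Set (MvPolynomial ι K), (∀ F ∈ S, ∃ d : ℕ, F.IsHomogeneous d) ∧ V = zeroLocus S}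
    (by
      refine ⟨{1}, ?_, ?_⟩
      · rintro F rfl
        exact ⟨0, isHomogeneous_one _ _⟩
      · symm
        rw [Set.eq_empty_iff_forall_notMem]
        intro p hp
        have := hp 1 rfl p.rep (by
          rw [p.submodule_eq]; exact Submodule.mem_span_singleton_self _)
        simp at this)
    (by
      intro A hA
      refine ⟨{F | (∃ d : ℕ, F.IsHomogeneous d) ∧ ∃ V ∈ A, ∀ p ∈ V, VanishesAt F p},
        fun F hF => hF.1, ?_⟩
      ext p
      constructor
      · rintro hp F ⟨-, V, hV, hF⟩
        exact hF p (hp V hV)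
      · intro hp V hV
        obtain ⟨S, hS, rfl⟩ := hA hV
        exact fun F hF => hp F ⟨hS F hF, _, hV, fun q hq => hq F hF⟩)
    (by
      rintro _ ⟨S, hS, rfl⟩ _ ⟨T, hT, rfl⟩
      refine ⟨{H | ∃ F ∈ S, ∃ G ∈ T, H = F * G}, ?_, ?_⟩
      · rintro _ ⟨F, hF, G, hG, rfl⟩
        obtain ⟨d, hd⟩ := hS F hF
        obtain ⟨e, he⟩ := hT G hG
        exact ⟨d + e, hd.mul he⟩
      · ext p
        constructor
        · rintro (hp | hp) _ ⟨F, hF, G, hG, rfl⟩ v hv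
          · rw [map_mul, hp F hF v hv, zero_mul]
          · rw [map_mul, hp G hG v hv, mul_zero]
        · intro hp
          by_contra hcon
          simp only [Set.mem_union, not_or, zeroLocus, Set.mem_ofPred_eq, not_forall] at hcon
          obtain ⟨⟨F, hF, hF'⟩, G, hG, hG'⟩ := hcon
          obtain ⟨d, hd⟩ := hS F hF
          obtain ⟨e, he⟩ := hT G hG
          have h := hp _ ⟨F, hF, G, hG, rfl⟩
          rw [vanishesAt_iff (hd.mul he), map_mul, mul_eq_zero] at h
          rw [vanishesAt_iff hd] at hF'
          rw [vanishesAt_iff he] at hG'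
          tauto)

/-- The dimension of a subset of projective space (Krull dimension of the subspace topology;
it is `⊥` for the empty set). -/
def dim (V : Set (Projectivization K (ι → K))) : WithBot ℕ∞ := topologicalKrullDim V

/-- The homogeneous ideal `I(V)` of a subset of projective space. -/
def vanishingIdeal (V : Set (Projectivization K (ι → K))) : Ideal (MvPolynomial ι K) where
  carrier := {F | ∀ p ∈ V, VanishesAt F p}
  add_mem' hF hG p hp v hv := by rw [map_add, hF p hp v hv, hG p hp v hv, add_zero]
  zero_mem' p _ v _ := map_zero _
  smul_mem' G F hF p hp v hv := by rw [smul_eq_mul, map_mul, hF p hp v hv, mul_zero]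

/-- The Hilbert function of `V`: the dimension of the degree-`n` part of the homogeneous
coordinate ring `K[x] / I(V)`. -/
def hilbertFunction (V : Set (Projectivization K (ι → K))) (n : ℕ) : ℕ :=
  Module.finrank K ((homogeneousSubmodule ι K n).map
    (Ideal.Quotient.mkₐ K (vanishingIdeal V)).toLinearMap)

/-- `V` has degree `e`: if `d = dim V`, then `e` is `d!` times the leading coefficient of the
Hilbert polynomial, that is `dim_K (K[x] / I(V))_n ∼ e * n ^ d / d!`. -/
def HasDegree (V : Set (Projectivization K (ι → K))) (e : ℕ) : Prop :=
  ∃ d : ℕ, dim V = d ∧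
    Filter.Tendsto (fun n : ℕ => (d.factorial * hilbertFunction V n : ℝ) / (n : ℝ) ^ d)
      Filter.atTop (nhds (e : ℝ))

/-- `Y` is an irreducible component of `V`: a maximal irreducible subset of `V`. -/
def IsIrredComponent (Y V : Set (Projectivization K (ι → K))) : Prop :=
  Maximal (fun S : Set (Projectivization K (ι → K)) => IsIrreducible S ∧ S ⊆ V) Y

/-- The linear subspace `ℙ(F)` of `ℙ(K^ι)` given by a vector subspace `F` of `K^ι`. -/
def linearSpace (F : Submodule K (ι → K)) : Set (Projectivization K (ι → K)) :=
  {p | p.submodule ≤ F}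

/-- The vertex of `X`: the points `p` of `X` such that the line `⟨p, q⟩` lies in `X` for every
point `q` of `X`. -/
def vertex (X : Set (Projectivization K (ι → K))) : Set (Projectivization K (ι → K)) :=
  {p | p ∈ X ∧ ∀ q ∈ X, linearSpace (p.submodule ⊔ q.submodule) ⊆ X}

/-- `X` is a cone. -/
def IsCone (X : Set (Projectivization K (ι → K))) : Prop := (vertex X).Nonempty

end Projective

/-! ### Tangent spaces and the dual variety

The projective space `ℙ(K^ι)` and its dual are both written in coordinates: the point `a` of one
is the hyperplane `∑ i, a i * w i = 0` of the other. -/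

section Dual

variable {K ι : Type*} [Field K] [Fintype ι]

/-- The differential of the polynomial `F` at `v`, `w ↦ ∑ i, ∂F/∂x_i (v) * w i`. -/
def differential (F : MvPolynomial ι K) (v : ι → K) : (ι → K) →ₗ[K] K :=
  ∑ i, eval v (pderiv i F) • LinearMap.proj i

/-- The embedded projective tangent space `T_z Z`, as a vector subspace of `K^ι`. -/
def tangentSpace (Z : Set (Projectivization K (ι → K))) (z : Projectivization K (ι → K)) :
    Submodule K (ι → K) :=
  ⨅ F ∈ vanishingIdeal Z, ⨅ v ∈ z.submodule, LinearMap.ker (differential F v)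

/-- The smooth points of an irreducible closed subset `Z`: the projective tangent space has
(projective) dimension `dim Z`. -/
def regularLocus (Z : Set (Projectivization K (ι → K))) : Set (Projectivization K (ι → K)) :=
  {z | z ∈ Z ∧ (Module.finrank K (tangentSpace Z z) : WithBot ℕ∞) = dim Z + 1}

/-- The dual `T^*` of the linear space `ℙ(T)`: the hyperplanes that contain `ℙ(T)`. -/
def dualSpace (T : Submodule K (ι → K)) : Submodule K (ι → K) where
  carrier := {a | ∀ w ∈ T, ∑ i, a i * w i = 0}
  add_mem' ha hb w hw := by
    simp only [Pi.add_apply, add_mul, Finset.sum_add_distrib, ha w hw, hb w hw, add_zero]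
  zero_mem' w _ := by simp
  smul_mem' c a ha w hw := by
    simp only [Pi.smul_apply, smul_eq_mul, mul_assoc, ← Finset.mul_sum, ha w hw, mul_zero]

/-- The dual variety `Z^*` of an irreducible closed subset `Z`: the closure of the union of the
linear spaces `(T_z Z)^*`, for `z` a smooth point of `Z`. -/
def dualVariety (Z : Set (Projectivization K (ι → K))) : Set (Projectivization K (ι → K)) :=
  closure (⋃ z ∈ regularLocus Z, linearSpace (dualSpace (tangentSpace Z z)))

end Dual

/-! ### The polar map, the Perazzo map and Special Perazzo cubic hypersurfaces -/

section Perazzo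

variable {K : Type*} [Field K] {N : ℕ}

/-- The Hessian matrix of `f`. -/
def hessian (f : MvPolynomial (Fin (N + 1)) K) :
    Matrix (Fin (N + 1)) (Fin (N + 1)) (MvPolynomial (Fin (N + 1)) K) :=
  Matrix.of fun i j => pderiv i (pderiv j f)

/-- The gradient of `f` at `v`. -/
def gradient (f : MvPolynomial (Fin (N + 1)) K) (v : Fin (N + 1) → K) : Fin (N + 1) → K :=
  fun i => eval v (pderiv i f)

/-- The graph of the polar map of `f`: the polar map is defined at `p`, with value `q`. -/
def PolarMap (f : MvPolynomial (Fin (N + 1)) K)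
    (p q : Projectivization K (Fin (N + 1) → K)) : Prop :=
  ∃ v ∈ p.submodule, gradient f v ≠ 0 ∧ gradient f v ∈ q.submodule

/-- The polar image `Z`: the closure of the image of the polar map. -/
def polarImage (f : MvPolynomial (Fin (N + 1)) K) :
    Set (Projectivization K (Fin (N + 1) → K)) :=
  closure {q | ∃ p, PolarMap f p q}

/-- The graph of the Perazzo map `p ↦ (T_{Φ(p)} Z)^*`, where `Φ` is the polar map: it is defined
at those `p` for which `Φ(p)` is a smooth point of `Z`. Its values are linear subspaces, that is
points of a Grassmannian. -/
def PerazzoMap (f : MvPolynomial (Fin (N + 1)) K) (p : Projectivization K (Fin (N + 1) → K))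
    (S : Submodule K (Fin (N + 1) → K)) : Prop :=
  ∃ q, PolarMap f p q ∧ q ∈ regularLocus (polarImage f) ∧
    S = dualSpace (tangentSpace (polarImage f) q)

/-- The vector of Plücker coordinates (maximal minors) of a basis of a subspace. -/
def pluckerVector {c : ℕ} {S : Submodule K (Fin (N + 1) → K)} (b : Module.Basis (Fin c) K S) :
    (Fin c ↪o Fin (N + 1)) → K :=
  fun I => (Matrix.of fun r s : Fin c => (b r : Fin (N + 1) → K) (I s)).det

/-- The closure `W` of the image of the Perazzo map, in the Plücker embedding of the Grassmannian
of `c`-dimensional vector subspaces of `K^(N+1)`, where `c` is the codimension of `Z`. -/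
def perazzoImage (f : MvPolynomial (Fin (N + 1)) K) (c : ℕ) :
    Set (Projectivization K ((Fin c ↪o Fin (N + 1)) → K)) :=
  closure {P | ∃ p S, PerazzoMap f p S ∧
    ∃ b : Module.Basis (Fin c) K S, pluckerVector b ∈ P.submodule}

/-- The fibre of the Perazzo map through `p`. -/
def perazzoFiber (f : MvPolynomial (Fin (N + 1)) K) (p : Projectivization K (Fin (N + 1) → K)) :
    Set (Projectivization K (Fin (N + 1) → K)) :=
  {p' | ∃ S, PerazzoMap f p S ∧ PerazzoMap f p' S}

/-- `V(f)` is a Special Perazzo cubic hypersurface: an irreducible cubic hypersurface with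
vanishing hessian, not a cone, such that, with `μ = dim W` the Perazzo rank, (the closures of) the
general fibres of the Perazzo map are linear spaces of dimension `N - μ` that all contain one
fixed linear space of dimension `N - μ - 1`. -/
def IsSpecialPerazzoCubic (f : MvPolynomial (Fin (N + 1)) K) : Prop :=
  f.IsHomogeneous 3 ∧ Irreducible f ∧ (hessian f).det = 0 ∧ ¬ IsCone (zeroLocus {f}) ∧
  ∃ c μ : ℕ, dim (polarImage f) + (c : WithBot ℕ∞) = (N : WithBot ℕ∞) ∧
    dim (perazzoImage f c) = (μ : WithBot ℕ∞) ∧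
    ∃ L : Submodule K (Fin (N + 1) → K), Module.finrank K L + μ = N ∧
      ∃ U : Set (Projectivization K (Fin (N + 1) → K)), IsOpen U ∧ U.Nonempty ∧
        ∀ p ∈ U, ∃ F : Submodule K (Fin (N + 1) → K), Module.finrank K F + μ = N + 1 ∧
          L ≤ F ∧ closure (perazzoFiber f p) = linearSpace F

/-! ### The canonical form and the determinantal hypersurface -/

variable {σ : ℕ}

/-- The indices `0, …, σ` of the coordinates `x_0, …, x_σ`. -/
def headIndex (h : 2 * σ ≤ N) (j : Fin (σ + 1)) : Fin (N + 1) :=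
  ⟨j, by omega⟩

/-- The indices `N - σ + 1, …, N` of the coordinates `x_{N-σ+1}, …, x_N`. -/
def tailIndex (h : 2 * σ ≤ N) (k : Fin σ) : Fin (N + 1) :=
  ⟨N - σ + 1 + k, by omega⟩

/-- The canonical form
`f = ∑_{j=0}^{σ} x_j C^j(x_{N-σ+1}, …, x_N) + D(x_{σ+1}, …, x_N)`, with quadratic forms `C^j`
and a cubic form `D`. -/
structure IsCanonicalForm (h : 2 * σ ≤ N) (f : MvPolynomial (Fin (N + 1)) K)
    (C : Fin (σ + 1) → MvPolynomial (Fin (N + 1)) K) (D : MvPolynomial (Fin (N + 1)) K) :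
    Prop where
  quadratic : ∀ j, (C j).IsHomogeneous 2
  quadratic_vars : ∀ j, C j ∈ supported K (Set.range (tailIndex h))
  cubic : D.IsHomogeneous 3
  cubic_vars : D ∈ supported K {i : Fin (N + 1) | σ < (i : ℕ)}
  eq : f = ∑ j, X (headIndex h j) * C j + D

/-- The `σ × σ` matrix `A` with entries `∑_{j=0}^{σ} (∂²C^j / ∂x_k ∂x_i) x_j`, where
`k, i ∈ {N-σ+1, …, N}`. -/
def detMatrix (h : 2 * σ ≤ N) (C : Fin (σ + 1) → MvPolynomial (Fin (N + 1)) K) :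
    Matrix (Fin σ) (Fin σ) (MvPolynomial (Fin (N + 1)) K) :=
  Matrix.of fun k i =>
    ∑ j, pderiv (tailIndex h k) (pderiv (tailIndex h i) (C j)) * X (headIndex h j)

/-- The equations `x_{σ+1}, …, x_N` of the linear space `M = ℙ^σ`. -/
def equationsM (K : Type*) [Field K] (N σ : ℕ) : Set (MvPolynomial (Fin (N + 1)) K) :=
  {F | ∃ i : Fin (N + 1), σ < (i : ℕ) ∧ F = X i}

/-- The determinantal locus `V(det A, x_{σ+1}, …, x_N)` in `M`. -/
def determinantalLocus (h : 2 * σ ≤ N) (C : Fin (σ + 1) → MvPolynomial (Fin (N + 1)) K) :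
    Set (Projectivization K (Fin (N + 1) → K)) :=
  zeroLocus ({(detMatrix h C).det} ∪ equationsM K N σ)

end Perazzo

end

end Perazzo

/-! Write `n = σ`, let `c j` be `C^j` as a quadratic form in the last `n` variables `x`, and let `y
= (x_0, …, x_σ)`. In the canonical form `∂f/∂x_j = C^j` for `j ≤ σ`, so the first `n + 1`
coordinates of the polar map depend on `n` variables only and satisfy an algebraic relation. `I(Z)`
is the kernel of the substitution of the partials of `f`; as `Z` is a hypersurface, it is generated
by a prime polynomial. This generator divides the relation, so it is a polynomial `g(y)`, and `g`
also generates the relations between the `c j` (`exists_equation_polarImage`).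

At a smooth point of `Z` the dual of the tangent space is the point `∇g`. Hence `Z^*` lies in `M`,
and its equations there are the relations between `φ j = c l * (∂g/∂y_j)(c)`, with `c l` a fixed
nonzero form. By dimension these relations form a principal prime ideal `(h)`.

Differentiating `g(c) = 0` gives `∑ φ j * ∂_k (c j) = 0`; by Euler's formula this says `A(φ) x = 0`.
Thus `det A` vanishes at `φ`, that is, `h ∣ det A` (`aeval_det_pencilMatrix`).

To see `det A ≠ 0` (`det_pencilMatrix_ne_zero`), suppose `A w = 0` with `w` not divisible by `h`,
and put `b = w(φ) ≠ 0`. Differentiating `A(φ) x = 0` along `b` shows that `D_b φ` lies, like `φ`, in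
the kernel of the Jacobian of `c`. That kernel has rank one, so `D_b φ` is proportional to `φ`, and
then `b` is proportional to `x` because the Jacobian of `φ` has rank `n`
(`mul_X_eq_of_map_pencilMatrix_mulVec_eq_zero`). Differentiating `A w = 0` in `y_j` and pairing with
the symmetric `A` gives `wᵀ A_j w = 0`, where `A_j` is the Hessian of `c j`. At `φ` this becomes `xᵀ
A_j x = 2 c j = 0` for all `j`, which is absurd.

So `Z^*` is defined in `M` by a prime factor of `det A`. It is therefore a component, and its degree
is `deg h ≤ deg det A = σ`. -/

open MvPolynomial Perazzo

/-! ### Closed sets, vanishing ideals and irreducibility in projective space. -/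

section ProjectiveVanishing

variable {K ι : Type*} [Field K]

theorem eval_smul_of_isHomogeneous {F : MvPolynomial ι K} {d : ℕ} (hF : F.IsHomogeneous d) (t : K)
    (v : ι → K) : eval (t • v) F = t ^ d * eval v F := by
  rw [eval_eq, eval_eq, Finset.mul_sum]
  refine Finset.sum_congr rfl fun m hm => ?_
  have hd : ∑ i ∈ m.support, m i = d := by
    have := hF (mem_support_iff.1 hm)
    rw [← this, Finsupp.weight_apply, Finsupp.sum]
    simp
  simp only [Pi.smul_apply, smul_eq_mul, mul_pow, Finset.prod_mul_distrib]
  rw [Finset.prod_pow_eq_pow_sum, hd]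
  ring

theorem isClosed_iff_exists_zeroLocus {V : Set (Projectivization K (ι → K))} :
    IsClosed V ↔
      ∃ S : Set (MvPolynomial ι K), (∀ F ∈ S, ∃ d : ℕ, F.IsHomogeneous d) ∧ V = zeroLocus S := by
  rw [← isOpen_compl_iff]
  change Vᶜᶜ ∈ _ ↔ _
  rw [compl_compl]
  rfl

theorem rep_mem_submodule (p : Projectivization K (ι → K)) : p.rep ∈ p.submodule := by
  rw [p.submodule_eq]; exact Submodule.mem_span_singleton_self _

theorem vanishingIdeal_anti {V W : Set (Projectivization K (ι → K))} (h : V ⊆ W) :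
    vanishingIdeal W ≤ vanishingIdeal V := fun _ hF p hp => hF p (h hp)

/-- The values at `v` of the components are the coefficients of `F(t v)` as a polynomial in `t`,
which is zero because it vanishes on an infinite field. -/
theorem eval_homogeneousComponent_eq_zero [Infinite K] {F : MvPolynomial ι K} {v : ι → K}
    (h : ∀ t : K, eval (t • v) F = 0) (n : ℕ) : eval v (homogeneousComponent n F) = 0 := by
  let q : Polynomial K := ∑ m ∈ Finset.range (F.totalDegree + 1),
    Polynomial.monomial m (eval v (homogeneousComponent m F))
  have hq : q = 0 := by
    refine Polynomial.funext fun t => ?_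
    rw [Polynomial.eval_zero, ← h t]
    conv_rhs => rw [← sum_homogeneousComponent F, map_sum]
    simp only [q, Polynomial.eval_finsetSum, Polynomial.eval_monomial]
    exact Finset.sum_congr rfl fun m _ => by
      rw [eval_smul_of_isHomogeneous (homogeneousComponent_isHomogeneous m F), mul_comm]
  by_cases hn : n < F.totalDegree + 1
  · have := congrArg (fun r => Polynomial.coeff r n) hq
    simpa [q, Polynomial.finsetSum_coeff, Polynomial.coeff_monomial, hn] using this
  · rw [homogeneousComponent_eq_zero _ _ (by omega), map_zero]

theorem homogeneousComponent_mem_vanishingIdeal [Infinite K]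
    {V : Set (Projectivization K (ι → K))} {F : MvPolynomial ι K} (hF : F ∈ vanishingIdeal V)
    (n : ℕ) : homogeneousComponent n F ∈ vanishingIdeal V := fun p hp _ hv =>
  eval_homogeneousComponent_eq_zero (fun t => hF p hp _ (p.submodule.smul_mem t hv)) n

theorem mem_closure_iff_vanishesAt [Infinite K] {V : Set (Projectivization K (ι → K))}
    {p : Projectivization K (ι → K)} :
    p ∈ closure V ↔ ∀ F ∈ vanishingIdeal V, VanishesAt F p := by
  constructor
  · intro hp F hF
    have hcl : IsClosed (zeroLocus {G | (∃ d : ℕ, G.IsHomogeneous d) ∧ G ∈ vanishingIdeal V}) :=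
      isClosed_iff_exists_zeroLocus.2 ⟨_, fun G hG => hG.1, rfl⟩
    have hsub := closure_minimal (fun q hq G hG => hG.2 q hq) hcl hp
    intro v hv
    rw [← sum_homogeneousComponent F, map_sum]
    exact Finset.sum_eq_zero fun n _ => hsub _ ⟨⟨n, homogeneousComponent_isHomogeneous n F⟩,
      homogeneousComponent_mem_vanishingIdeal hF n⟩ v hv
  · intro h
    obtain ⟨S, -, hS⟩ := isClosed_iff_exists_zeroLocus.1 (isClosed_closure (s := V))
    rw [hS]
    refine fun F hF => h F fun q hq => ?_
    have := subset_closure hq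
    rw [hS] at this
    exact this F hF

theorem vanishingIdeal_closure [Infinite K] (V : Set (Projectivization K (ι → K))) :
    vanishingIdeal (closure V) = vanishingIdeal V :=
  le_antisymm (vanishingIdeal_anti subset_closure)
    fun F hF _ hp => mem_closure_iff_vanishesAt.1 hp F hF

theorem IsClosed.subset_of_vanishingIdeal_le [Infinite K] {V W : Set (Projectivization K (ι → K))}
    (hW : IsClosed W) (h : vanishingIdeal W ≤ vanishingIdeal V) : V ⊆ W := fun p hp => by
  rw [← hW.closure_eq]
  exact mem_closure_iff_vanishesAt.2 fun F hF => h hF p hp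

theorem one_notMem_vanishingIdeal {V : Set (Projectivization K (ι → K))} (hV : V.Nonempty) :
    (1 : MvPolynomial ι K) ∉ vanishingIdeal V := fun h => by
  obtain ⟨p, hp⟩ := hV
  simpa using h p hp _ (rep_mem_submodule p)

-- The ideal is homogeneous, so primality may be tested on homogeneous `F` and `G`, for which the
-- loci `V(F)` and `V(G)` are closed.
attribute [local instance] MvPolynomial.gradedAlgebra in
theorem IsIrreducible.isPrime_vanishingIdeal [Infinite K] {V : Set (Projectivization K (ι → K))}
    (hV : IsIrreducible V) : (vanishingIdeal V).IsPrime := by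
  refine Ideal.IsHomogeneous.isPrime_of_homogeneous_mem_or_mem
    (𝒜 := homogeneousSubmodule ι K) ?_ ?_ ?_
  · intro n F hF
    have h : ((DirectSum.decompose (homogeneousSubmodule ι K) F n : _) : MvPolynomial ι K) =
        homogeneousComponent n F := decomposition.decompose'_apply F n
    rw [h]
    exact homogeneousComponent_mem_vanishingIdeal hF n
  · exact fun h => one_notMem_vanishingIdeal hV.nonempty (h ▸ Submodule.mem_top)
  · rintro F G ⟨d, hF⟩ ⟨e, hG⟩ hFG
    have hcl : ∀ {H : MvPolynomial ι K} {d : ℕ}, H.IsHomogeneous d → IsClosed (zeroLocus {H}) :=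
      fun hH => isClosed_iff_exists_zeroLocus.2 ⟨_, by rintro _ rfl; exact ⟨_, hH⟩, rfl⟩
    have := isPreirreducible_iff_isClosed_union_isClosed.1 hV.isPreirreducible
      _ _ (hcl hF) (hcl hG) (fun p hp => ?_)
    · exact this.imp (fun h p hp => h hp F rfl) (fun h p hp => h hp G rfl)
    · have h0 := hFG p hp _ (rep_mem_submodule p)
      rw [map_mul, mul_eq_zero] at h0
      refine h0.imp (fun h => ?_) (fun h => ?_)
      · rintro _ rfl; exact (vanishesAt_iff hF).2 h
      · rintro _ rfl; exact (vanishesAt_iff hG).2 h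

theorem isIrreducible_of_isPrime_vanishingIdeal [Infinite K]
    {V : Set (Projectivization K (ι → K))} (hV : (vanishingIdeal V).IsPrime) : IsIrreducible V := by
  refine ⟨?_, isPreirreducible_iff_isClosed_union_isClosed.2 fun Z₁ Z₂ h₁ h₂ h => ?_⟩
  · by_contra hne
    rw [Set.not_nonempty_iff_eq_empty] at hne
    exact hV.one_notMem (by rw [hne]; exact fun p hp => absurd hp (Set.notMem_empty p))
  · by_contra! hcon
    have key : ∀ Z : Set (Projectivization K (ι → K)), IsClosed Z → ¬ V ⊆ Z →
        ∃ F ∈ vanishingIdeal Z, F ∉ vanishingIdeal V := fun Z hZ hVZ => by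
      by_contra! hc
      exact hVZ (hZ.subset_of_vanishingIdeal_le hc)
    obtain ⟨F, hF, hF'⟩ := key _ h₁ hcon.1
    obtain ⟨G, hG, hG'⟩ := key _ h₂ hcon.2
    refine (hV.mem_or_mem (x := F) (y := G) fun p hp v hv => ?_).elim hF' hG'
    rw [map_mul]
    rcases h hp with hp | hp
    · rw [hF p hp v hv, zero_mul]
    · rw [hG p hp v hv, mul_zero]

end ProjectiveVanishing

/-! ### From the topological dimension to a principal prime ideal. -/

section Dimension

variable {K ι : Type*} [Field K]

theorem exists_nat_of_add_one_eq {d : WithBot ℕ∞} {n : ℕ} (h : d + 1 = (n : WithBot ℕ∞)) :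
    ∃ m : ℕ, n = m + 1 ∧ d = (m : WithBot ℕ∞) := by
  induction d using WithBot.recBotCoe with
  | bot => simp at h
  | coe d =>
    have h' : d + 1 = (n : ℕ∞) := by exact_mod_cast h
    induction d using ENat.recTopCoe with
    | top => simp at h'
    | coe d => exact ⟨d, by exact_mod_cast h'.symm, rfl⟩

theorem constantCoeff_eq_zero_of_mem_vanishingIdeal
    {V : Set (Projectivization K (ι → K))} (hV : V.Nonempty) {F : MvPolynomial ι K}
    (hF : F ∈ vanishingIdeal V) : constantCoeff F = 0 := by
  obtain ⟨p, hp⟩ := hV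
  rw [← hF p hp 0 (zero_mem _)]
  simp

theorem exists_X_notMem_vanishingIdeal {V : Set (Projectivization K (ι → K))} (hV : V.Nonempty) :
    ∃ i, (X i : MvPolynomial ι K) ∉ vanishingIdeal V := by
  obtain ⟨p, hp⟩ := hV
  by_contra! h
  refine p.rep_nonzero (funext fun i => ?_)
  simpa using h i p hp _ (rep_mem_submodule p)

/-- A nonzero prime ideal of a polynomial ring in `n + 1` variables whose quotient is the coordinate
ring of a projective set of dimension `n - 1` is generated by a prime element. -/
theorem exists_prime_span_of_dim_add_one [Infinite K] {n : ℕ}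
    {V : Set (Projectivization K (ι → K))}
    (hdim : dim V + 1 = (n : WithBot ℕ∞))
    (θ : MvPolynomial (Fin (n + 1)) K →ₐ[K] MvPolynomial ι K)
    (hθ : ∀ F, ∃ r, F - θ r ∈ vanishingIdeal V)
    (hprime : ((vanishingIdeal V).comap θ).IsPrime)
    (hne : (vanishingIdeal V).comap θ ≠ ⊥) :
    ∃ g : MvPolynomial (Fin (n + 1)) K, Prime g ∧ (vanishingIdeal V).comap θ = Ideal.span {g} := by
  obtain ⟨m, hm, hd⟩ := exists_nat_of_add_one_eq hdim
  obtain ⟨g, hgI, hg⟩ := hprime.exists_mem_prime_of_ne_bot hne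
  refine ⟨g, hg, ?_⟩
  by_contra hneq
  have hlt : Ideal.span {g} < (vanishingIdeal V).comap θ :=
    lt_of_le_of_ne ((Ideal.span_singleton_le_iff_mem _).2 hgI) (Ne.symm hneq)
  obtain ⟨l, hl⟩ := Order.le_krullDim_iff.1 hd.ge
  have himg : ∀ W : TopologicalSpace.IrreducibleCloseds V,
      IsIrreducible (Subtype.val '' (W : Set V)) := fun W =>
    W.isIrreducible.image _ continuous_subtype_val.continuousOn
  let Φ : TopologicalSpace.IrreducibleCloseds V → PrimeSpectrum (MvPolynomial (Fin (n + 1)) K) :=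
    fun W => ⟨(vanishingIdeal (Subtype.val '' (W : Set V))).comap θ,
      (himg W).isPrime_vanishingIdeal.comap θ⟩
  have hsubV : ∀ W : TopologicalSpace.IrreducibleCloseds V,
      vanishingIdeal V ≤ vanishingIdeal (Subtype.val '' (W : Set V)) := fun W =>
    vanishingIdeal_anti (by rintro _ ⟨x, -, rfl⟩; exact x.2)
  have hΦ : ∀ W W' : TopologicalSpace.IrreducibleCloseds V, W < W' → Φ W' < Φ W := by
    intro W W' hWW'
    have hle : Φ W' ≤ Φ W := by
      change Ideal.comap _ _ ≤ Ideal.comap _ _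
      exact Ideal.comap_mono (vanishingIdeal_anti (Set.image_mono hWW'.le))
    refine lt_of_le_not_ge hle fun hge => hWW'.not_ge ?_
    have hge' : vanishingIdeal (Subtype.val '' (W : Set V)) ≤
        vanishingIdeal (Subtype.val '' (W' : Set V)) := by
      intro F hF
      obtain ⟨r, hr⟩ := hθ F
      have h1 : r ∈ (vanishingIdeal (Subtype.val '' (W : Set V))).comap θ := by
        rw [Ideal.mem_comap]
        have := sub_mem hF (hsubV W hr)
        rwa [sub_sub_cancel] at this
      have h2 : θ r ∈ vanishingIdeal (Subtype.val '' (W' : Set V)) := hge h1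
      have := add_mem (hsubV W' hr) h2
      rwa [sub_add_cancel] at this
    intro x hx
    obtain ⟨T, hT, hWT⟩ := isClosed_induced_iff.1 W.isClosed
    have hx' := hT.subset_of_vanishingIdeal_le
      ((vanishingIdeal_anti (by rintro _ ⟨y, hy, rfl⟩; rw [← hWT] at hy; exact hy)).trans hge')
      ⟨x, hx, rfl⟩
    change x ∈ (W : Set V)
    rw [← hWT]
    exact hx'
  -- The irrelevant ideal: it strictly contains the ideal of every nonempty projective set, so it
  -- lengthens each chain by one.
  let top : PrimeSpectrum (MvPolynomial (Fin (n + 1)) K) :=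
    ⟨(RingHom.ker (constantCoeff (R := K) (σ := ι))).comap θ,
      (RingHom.ker_isPrime (constantCoeff (R := K) (σ := ι))).comap θ⟩
  have htop : ∀ W, Φ W < top := by
    intro W
    have hne := (himg W).nonempty
    have hle : Φ W ≤ top := by
      change Ideal.comap _ _ ≤ Ideal.comap _ _
      exact Ideal.comap_mono fun F hF => constantCoeff_eq_zero_of_mem_vanishingIdeal hne hF
    refine lt_of_le_not_ge hle fun hge => ?_
    obtain ⟨i, hi⟩ := exists_X_notMem_vanishingIdeal hne
    obtain ⟨r, hr⟩ := hθ (X i)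
    refine hi ?_
    have h1 : r ∈ top.asIdeal := by
      change constantCoeff (θ r) = 0
      have := constantCoeff_eq_zero_of_mem_vanishingIdeal hne (hsubV W hr)
      simpa [sub_eq_zero, eq_comm] using this
    have h2 : θ r ∈ vanishingIdeal (Subtype.val '' (W : Set V)) := hge h1
    have := add_mem (hsubV W hr) h2
    rwa [sub_add_cancel] at this
  let l' : LTSeries (PrimeSpectrum (MvPolynomial (Fin (n + 1)) K)) :=
    { length := l.length
      toFun := fun i => Φ (l i.rev)
      step := fun i => hΦ _ _ (l.strictMono (by
        rw [Fin.lt_def]; simp only [Fin.val_rev, Fin.val_succ, Fin.val_castSucc]; omega)) }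
  let P0 : PrimeSpectrum (MvPolynomial (Fin (n + 1)) K) := ⟨⊥, Ideal.isPrime_bot⟩
  let P1 : PrimeSpectrum (MvPolynomial (Fin (n + 1)) K) :=
    ⟨Ideal.span {g}, (Ideal.span_singleton_prime hg.ne_zero).2 hg⟩
  have h01 : P0 < P1 := by
    change (⊥ : Ideal _) < Ideal.span {g}
    rw [bot_lt_iff_ne_bot, Ne, Ideal.span_singleton_eq_bot]
    exact hg.ne_zero
  have h1 : P1 < l'.head := by
    refine lt_of_lt_of_le (b := (⟨_, hprime⟩ : PrimeSpectrum _)) hlt ?_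
    exact Ideal.comap_mono (hsubV _)
  -- If the ideal were larger than `(g)`, the chain `0 < (g) < I(V) ≤ … < irrelevant ideal` would
  -- have length `m + 3 = n + 2`, exceeding the Krull dimension `n + 1`.
  let L := (((l'.cons P1 h1).cons P0 (by simpa using h01)).snoc top (by
    simp only [RelSeries.last_cons]
    exact htop _))
  have hL : L.length = m + 3 := by simp [L, l', hl]
  have hle : (L.length : WithBot ℕ∞) ≤ ringKrullDim (MvPolynomial (Fin (n + 1)) K) :=
    Order.LTSeries.length_le_krullDim L
  rw [MvPolynomial.ringKrullDim_of_isNoetherianRing, ringKrullDim_eq_zero_of_field, hL] at hle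
  simp only [Nat.card_eq_fintype_card, Fintype.card_fin, zero_add] at hle
  have : m + 3 ≤ n + 1 := by exact_mod_cast hle
  omega

end Dimension

/-! ### Derivations and algebraic dependence. -/

section Derivations

variable {K : Type*} [Field K]

theorem derivation_aeval {ι A : Type*} [Fintype ι] [CommRing A] [Algebra K A] (δ : Derivation K A A)
    (c : ι → A) (g : MvPolynomial ι K) :
    δ (aeval c g) = ∑ j, aeval c (pderiv j g) * δ (c j) := by
  classical
  induction g using MvPolynomial.induction_on with
  | C a => simp
  | add p q hp hq => simp [hp, hq, add_mul, Finset.sum_add_distrib]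
  | mul_X p i hp =>
    simp only [map_mul, aeval_X, Derivation.leibniz, hp, smul_eq_mul, map_add, add_mul,
      Finset.sum_add_distrib, pderiv_X, Finset.mul_sum]
    congr 1
    · rw [Finset.sum_eq_single i]
      · simp
      · intro j _ hj; simp [Ne.symm hj]
      · simp
    · exact Finset.sum_congr rfl fun j _ => by ring

theorem not_algebraicIndependent_of_card_lt {m n : ℕ} (h : n < m)
    (c : Fin m → MvPolynomial (Fin n) K) : ¬ AlgebraicIndependent K c := by
  intro hc
  have := hc.lift_cardinalMk_le_trdeg
  rw [MvPolynomial.trdeg_of_isDomain] at this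
  simp at this
  omega

theorem ker_aeval_ne_bot {n : ℕ} (c : Fin (n + 1) → MvPolynomial (Fin n) K) :
    RingHom.ker (aeval c : MvPolynomial (Fin (n + 1)) K →ₐ[K] _) ≠ ⊥ := fun h =>
  not_algebraicIndependent_of_card_lt (Nat.lt_succ_self n) c
    ((RingHom.injective_iff_ker_eq_bot _).2 h)

/-- Applying `δ` to a relation `p(a) = 0` gives `p'(a) * δ a = 0`: either `δ a = 0`, or `p'` is a
nonzero relation of lower degree and the argument repeats. -/
theorem derivation_eq_zero_of_isAlgebraic {A : Type*} [CommRing A] [IsDomain A] [Algebra K A]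
    [CharZero K] (B : Subalgebra K A) (δ : Derivation K A A) (hB : ∀ b ∈ B, δ b = 0) {a : A}
    (ha : IsAlgebraic B a) : δ a = 0 := by
  obtain ⟨p, hp0, hp⟩ := ha
  have hchar : CharZero B := charZero_of_injective_algebraMap (algebraMap K B).injective
  induction hn : p.natDegree using Nat.strong_induction_on generalizing p with
  | _ n ih =>
    have hd : δ (Polynomial.aeval a p) = Polynomial.aeval a (Polynomial.derivative p) * δ a := by
      clear hp hp0 hn ih
      induction p using Polynomial.induction_on' with
      | add p q hp hq => simp [hp, hq, add_mul]
      | monomial n b =>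
        have hb : δ (algebraMap B A b) = 0 := hB _ b.2
        simp only [Polynomial.aeval_monomial, Derivation.leibniz, Derivation.leibniz_pow, hb,
          Polynomial.derivative_monomial, smul_eq_mul, map_mul, map_natCast]
        simp
        ring
    rw [hp, map_zero, eq_comm, mul_eq_zero] at hd
    have hpos : p.natDegree ≠ 0 := by
      intro h
      rw [Polynomial.eq_C_of_natDegree_eq_zero h] at hp hp0
      rw [Polynomial.aeval_C] at hp
      have : p.coeff 0 = 0 := Subtype.ext hp
      rw [this, map_zero] at hp0
      exact hp0 rfl
    have hlt := Polynomial.natDegree_derivative_lt hpos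
    have hne : Polynomial.derivative p ≠ 0 := fun h =>
      hpos (Polynomial.derivative_eq_zero.1 h)
    exact hd.elim (fun h0 => ih _ (hn ▸ hlt) _ hne h0 rfl) id

/-- The `c j` have transcendence degree `n`: if the variable `i` occurs in `g`, it occurs in all
nonzero multiples of `g`, so the `c j` with `j ≠ i` are independent and form a transcendence basis.
Equivalently, the Jacobian of `c` has rank `n`. -/
theorem derivation_eq_zero_of_ker_aeval_eq_span [CharZero K] {n : ℕ}
    {c : Fin (n + 1) → MvPolynomial (Fin n) K} {g : MvPolynomial (Fin (n + 1)) K}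
    (hc : RingHom.ker (aeval c : MvPolynomial (Fin (n + 1)) K →ₐ[K] _) = Ideal.span {g})
    (δ : Derivation K (MvPolynomial (Fin n) K) (MvPolynomial (Fin n) K))
    (hδ : ∀ j, δ (c j) = 0) : δ = 0 := by
  have hg0 : g ≠ 0 := fun h => ker_aeval_ne_bot c (by rw [hc, h]; simp)
  have hgc : aeval c g = 0 := by
    have : g ∈ RingHom.ker (aeval c : MvPolynomial (Fin (n + 1)) K →ₐ[K] _) := by
      rw [hc]; exact Ideal.mem_span_singleton_self g
    exact this
  obtain ⟨i, hi⟩ : ∃ i, g.degreeOf i ≠ 0 := by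
    by_contra! h
    obtain ⟨a, rfl⟩ : ∃ a, g = C a := ⟨_, vars_eq_empty_iff_eq_C.1
      (Finset.eq_empty_of_forall_notMem fun i hi => by
        rw [mem_vars_iff_degreeOf_ne_zero] at hi; exact hi (h i))⟩
    rw [aeval_C, algebraMap_eq, C_eq_zero] at hgc
    exact hg0 (by rw [hgc, C_0])
  have hind : AlgebraicIndependent K (c ∘ i.succAbove) := by
    rw [algebraicIndependent_iff]
    intro r hr
    have hinj := i.succAbove_right_injective
    have hmem : rename i.succAbove r ∈ Ideal.span {g} := by
      rw [← hc, RingHom.mem_ker]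
      exact (aeval_rename _ _ _).trans hr
    obtain ⟨q, hq⟩ := Ideal.mem_span_singleton.1 hmem
    by_contra hr0
    have hq0 : q ≠ 0 := by
      rintro rfl
      rw [mul_zero] at hq
      exact hr0 (rename_injective _ hinj (by rw [hq, map_zero]))
    have h1 : (rename i.succAbove r).degreeOf i = 0 := by
      by_contra h
      rw [← ne_eq, ← mem_vars_iff_degreeOf_ne_zero] at h
      have := vars_rename _ _ h
      simp [Fin.succAbove_ne] at this
    rw [hq, degreeOf_mul_eq hg0 hq0] at h1
    omega
  have hbasis := hind.isTranscendenceBasis_of_lift_trdeg_le_of_finite (by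
    rw [MvPolynomial.trdeg_of_isDomain]; simp)
  have halg := hbasis.isAlgebraic
  refine derivation_ext fun k => ?_
  refine derivation_eq_zero_of_isAlgebraic (Algebra.adjoin K (Set.range (c ∘ i.succAbove))) δ
    (fun b hb => ?_) (halg.isAlgebraic (X k))
  induction hb using Algebra.adjoin_induction with
  | mem x hx => obtain ⟨j, rfl⟩ := hx; exact hδ _
  | algebraMap r => exact δ.map_algebraMap r
  | add x y _ _ hx hy => rw [map_add, hx, hy, add_zero]
  | mul x y _ _ hx hy => rw [Derivation.leibniz, hx, hy, smul_zero, smul_zero, add_zero]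

end Derivations

/-! ### The Hessian matrix of a linear system of quadratic forms. -/

section QuadraticPencil

variable {K : Type*} [Field K]

theorem pderiv_comm {ι : Type*} (i k : ι) (F : MvPolynomial ι K) :
    pderiv i (pderiv k F) = pderiv k (pderiv i F) := by
  classical
  have : ⁅pderiv i, pderiv k⁆ = (0 : Derivation K (MvPolynomial ι K) (MvPolynomial ι K)) :=
    derivation_ext fun j => by
      rw [Derivation.commutator_apply]
      simp only [pderiv_X, Pi.single_apply]
      split_ifs <;> simp
  have h := congrArg (fun δ => δ F) this
  simpa [Derivation.commutator_apply, sub_eq_zero] using h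

theorem mkDerivation_eq_sum {ι : Type*} [Fintype ι] (u : ι → MvPolynomial ι K)
    (F : MvPolynomial ι K) : mkDerivation K u F = ∑ k, u k * pderiv k F := by
  have h := derivation_aeval (mkDerivation K u) X F
  simp only [aeval_X_left, AlgHom.id_apply, mkDerivation_X] at h
  rw [h]
  exact Finset.sum_congr rfl fun k _ => mul_comm _ _

theorem eq_zero_of_sum_mul_pderiv_eq_zero {m n : ℕ} {c : Fin m → MvPolynomial (Fin n) K}
    (hc : ∀ δ : Derivation K (MvPolynomial (Fin n) K) (MvPolynomial (Fin n) K),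
      (∀ j, δ (c j) = 0) → δ = 0)
    {u : Fin n → MvPolynomial (Fin n) K} (hu : ∀ j, ∑ k, u k * pderiv k (c j) = 0) : u = 0 := by
  have h := hc (mkDerivation K u) fun j => by rw [mkDerivation_eq_sum, hu]
  funext k
  rw [← mkDerivation_X K u k, h]
  rfl

/-- Two vectors in the kernel of an `n × (n + 1)` matrix with independent rows are proportional. -/
theorem mul_eq_mul_of_mulVec_eq_zero {A : Type*} [CommRing A] [IsDomain A] {n : ℕ}
    {M : Matrix (Fin n) (Fin (n + 1)) A} (hM : ∀ u, Matrix.vecMul u M = 0 → u = 0)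
    {φ ψ : Fin (n + 1) → A} (hφ : M.mulVec φ = 0) (hψ : M.mulVec ψ = 0) {l : Fin (n + 1)}
    (hl : φ l ≠ 0) (j : Fin (n + 1)) : φ l * ψ j = ψ l * φ j := by
  have h0 : M.mulVec (φ l • ψ - ψ l • φ) = 0 := by
    rw [Matrix.mulVec_sub, Matrix.mulVec_smul, Matrix.mulVec_smul, hφ, hψ]; simp
  set χ := φ l • ψ - ψ l • φ with hχ
  have hχl : χ l = 0 := by simp [hχ, mul_comm]
  have key : (fun i => χ (l.succAbove i)) = 0 := by
    by_contra hne
    -- A nonzero `χ` with `χ l = 0` makes the minor without column `l` singular. A left kernel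
    -- vector of that minor kills column `l` too, because `M φ = 0` and `φ l ≠ 0`; this contradicts
    -- the independence of the rows.
    have hdet : (M.submatrix id l.succAbove).det = 0 := by
      refine Matrix.exists_mulVec_eq_zero_iff.1 ⟨_, hne, funext fun k => ?_⟩
      have := congrFun h0 k
      simp only [Matrix.mulVec, dotProduct] at this ⊢
      rw [Fin.sum_univ_succAbove _ l, hχl, mul_zero, zero_add] at this
      exact this
    obtain ⟨u, hu, huM⟩ := Matrix.exists_vecMul_eq_zero_iff.2 hdet
    have hoff : ∀ i, Matrix.vecMul u M (l.succAbove i) = 0 := fun i => congrFun huM i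
    have hul : Matrix.vecMul u M l = 0 := by
      have h1 : Matrix.vecMul u M ⬝ᵥ φ = 0 := by
        rw [← Matrix.dotProduct_mulVec, hφ, dotProduct_zero]
      rw [dotProduct, Fin.sum_univ_succAbove _ l] at h1
      simp only [hoff, zero_mul, Finset.sum_const_zero, add_zero] at h1
      exact (mul_eq_zero.1 h1).resolve_right hl
    refine hu (hM u (funext fun i => ?_))
    rcases Fin.eq_self_or_eq_succAbove l i with rfl | ⟨i, rfl⟩
    · exact hul
    · exact hoff i
  have hj : χ j = 0 := by
    rcases Fin.eq_self_or_eq_succAbove l j with rfl | ⟨i, rfl⟩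
    · exact hχl
    · exact congrFun key i
  simpa [hχ, sub_eq_zero] using hj

/-- The second derivatives of a family of quadratic forms. -/
noncomputable def secondDerivative {n m : ℕ} (c : Fin m → MvPolynomial (Fin n) K) (k i : Fin n)
    (j : Fin m) : K := constantCoeff (pderiv k (pderiv i (c j)))

/-- The Hessian matrix of the general member of a linear system of quadratic forms. -/
noncomputable def pencilMatrix {n m : ℕ} (c : Fin m → MvPolynomial (Fin n) K) :
    Matrix (Fin n) (Fin n) (MvPolynomial (Fin m) K) :=
  Matrix.of fun k i => ∑ j, C (secondDerivative c k i j) * X j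

variable {n m : ℕ} {c : Fin m → MvPolynomial (Fin n) K}

theorem secondDerivative_comm (k i : Fin n) (j : Fin m) :
    secondDerivative c k i j = secondDerivative c i k j := by
  rw [secondDerivative, pderiv_comm]; rfl

theorem pencilMatrix_transpose : (pencilMatrix c).transpose = pencilMatrix c := by
  ext1 k i
  simp only [pencilMatrix, Matrix.transpose_apply, Matrix.of_apply]
  exact Finset.sum_congr rfl fun j _ => by rw [secondDerivative_comm]

theorem pencilMatrix_isHomogeneous (k i : Fin n) : (pencilMatrix c k i).IsHomogeneous 1 := by
  rw [pencilMatrix, Matrix.of_apply]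
  exact IsHomogeneous.sum _ _ _ fun j _ => isHomogeneous_C_mul_X _ j

theorem det_pencilMatrix_isHomogeneous : (pencilMatrix c).det.IsHomogeneous n := by
  rw [Matrix.det_apply']
  refine IsHomogeneous.sum _ _ _ fun s _ => ?_
  have h := IsHomogeneous.prod Finset.univ (fun i => pencilMatrix c (s i) i) (fun _ => 1)
    fun i _ => pencilMatrix_isHomogeneous _ _
  simp only [Finset.sum_const, Finset.card_univ, Fintype.card_fin, smul_eq_mul, mul_one] at h
  have h2 := h.C_mul ((Equiv.Perm.sign s : ℤ) : K)
  simpa using h2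

theorem C_secondDerivative (hc : ∀ j, (c j).IsHomogeneous 2) (k i : Fin n) (j : Fin m) :
    C (secondDerivative c k i j) = pderiv k (pderiv i (c j)) := by
  have h : (pderiv k (pderiv i (c j))).IsHomogeneous 0 := (hc j).pderiv.pderiv
  rw [← totalDegree_zero_iff_isHomogeneous, totalDegree_eq_zero_iff_eq_C] at h
  rw [secondDerivative, constantCoeff_eq, ← h]

theorem sum_secondDerivative_mul_X (hc : ∀ j, (c j).IsHomogeneous 2) (k : Fin n) (j : Fin m) :
    ∑ i, C (secondDerivative c k i j) * X i = pderiv k (c j) := by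
  have h := ((hc j).pderiv (i := k)).sum_X_mul_pderiv
  simp only [Nat.reduceSub, one_smul] at h
  rw [← h]
  exact Finset.sum_congr rfl fun i _ => by
    rw [C_secondDerivative hc, pderiv_comm, mul_comm]

theorem sum_sum_secondDerivative (hc : ∀ j, (c j).IsHomogeneous 2) (j : Fin m) :
    ∑ k, X k * ∑ i, C (secondDerivative c k i j) * X i = 2 * c j := by
  simp only [sum_secondDerivative_mul_X hc]
  rw [(hc j).sum_X_mul_pderiv, nsmul_eq_mul]
  norm_num

theorem map_pencilMatrix_mulVec {A : Type*} [CommRing A] [Algebra K A] (φ : Fin m → A)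
    (u : Fin n → A) (k : Fin n) :
    ((pencilMatrix c).map (aeval φ)).mulVec u k =
      ∑ j, φ j * ∑ i, algebraMap K A (secondDerivative c k i j) * u i := by
  simp only [Matrix.mulVec, dotProduct, Matrix.map_apply, pencilMatrix, Matrix.of_apply, map_sum,
    map_mul, aeval_X, aeval_C, Finset.sum_mul, Finset.mul_sum]
  rw [Finset.sum_comm]
  exact Finset.sum_congr rfl fun j _ => Finset.sum_congr rfl fun i _ => by ring

theorem map_pencilMatrix_mulVec_X (hc : ∀ j, (c j).IsHomogeneous 2)
    {φ : Fin m → MvPolynomial (Fin n) K} (hrel : ∀ k, ∑ j, φ j * pderiv k (c j) = 0) :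
    ((pencilMatrix c).map (aeval φ)).mulVec X = 0 := by
  funext k
  rw [map_pencilMatrix_mulVec]
  simp only [algebraMap_eq, sum_secondDerivative_mul_X hc, hrel, Pi.zero_apply]

/-- The vector of variables is a kernel vector of the matrix at `φ`, nonzero since there is at least
one variable. -/
theorem aeval_det_pencilMatrix (hn : n ≠ 0) (hc : ∀ j, (c j).IsHomogeneous 2)
    {φ : Fin m → MvPolynomial (Fin n) K} (hrel : ∀ k, ∑ j, φ j * pderiv k (c j) = 0) :
    aeval φ (pencilMatrix c).det = 0 := by
  have h := Matrix.exists_mulVec_eq_zero_iff.1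
    ⟨X, fun h => X_ne_zero (R := K) (⟨0, Nat.pos_of_ne_zero hn⟩ : Fin n) (congrFun h _),
      map_pencilMatrix_mulVec_X hc hrel⟩
  rw [← h, AlgHom.map_det]
  rfl

/-- Differentiate `A w = 0` in the `j`-th variable and pair with `w`: the term `wᵀ A (∂_j w)`
vanishes by symmetry of `A`. -/
theorem sum_secondDerivative_mul_eq_zero {w : Fin n → MvPolynomial (Fin m) K}
    (hw : (pencilMatrix c).mulVec w = 0) (j : Fin m) :
    ∑ k, w k * ∑ i, C (secondDerivative c k i j) * w i = 0 := by
  have h1 : ∀ k, pderiv j ((pencilMatrix c).mulVec w k) =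
      ∑ i, C (secondDerivative c k i j) * w i +
        (pencilMatrix c).mulVec (fun i => pderiv j (w i)) k := by
    intro k
    simp only [Matrix.mulVec, dotProduct, map_sum, Derivation.leibniz, smul_eq_mul]
    rw [← Finset.sum_add_distrib]
    refine Finset.sum_congr rfl fun i _ => ?_
    have : pderiv j (pencilMatrix c k i) = C (secondDerivative c k i j) := by
      classical
      simp [pencilMatrix, pderiv_X, Pi.single_apply]
    rw [this]; ring
  have h2 : ∀ v : Fin n → MvPolynomial (Fin m) K,
      ∑ k, w k * (pencilMatrix c).mulVec v k = 0 := by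
    intro v
    change w ⬝ᵥ (pencilMatrix c).mulVec v = 0
    rw [Matrix.dotProduct_mulVec, ← Matrix.mulVec_transpose, pencilMatrix_transpose, hw,
      zero_dotProduct]
  have h3 := h2 fun i => pderiv j (w i)
  have h4 : ∑ k, (w k * ∑ i, C (secondDerivative c k i j) * w i +
      w k * (pencilMatrix c).mulVec (fun i => pderiv j (w i)) k) = 0 :=
    Finset.sum_eq_zero fun k _ => by rw [← mul_add, ← h1, hw, Pi.zero_apply, map_zero, mul_zero]
  rwa [Finset.sum_add_distrib, h3, add_zero] at h4

end QuadraticPencil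

/-! ### Nonvanishing of the determinant. -/

section Nondegenerate

variable {K : Type*} [Field K] [CharZero K] {n : ℕ} {c φ : Fin (n + 1) → MvPolynomial (Fin n) K}

/-- Differentiating `hrel` along `u` puts the derivative `ψ` of `φ` in the rank-one kernel that
contains `φ`. Euler's formula says that `φ` is, up to the factor `d`, its own derivative along `X`,
so a combination of `u` and `X` differentiates `φ` to zero and must vanish by `hδφ`. -/
theorem mul_X_eq_of_map_pencilMatrix_mulVec_eq_zero (hc : ∀ j, (c j).IsHomogeneous 2)
    (hrel : ∀ k, ∑ j, φ j * pderiv k (c j) = 0)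
    (hδc : ∀ δ : Derivation K (MvPolynomial (Fin n) K) (MvPolynomial (Fin n) K),
      (∀ j, δ (c j) = 0) → δ = 0)
    (hδφ : ∀ δ : Derivation K (MvPolynomial (Fin n) K) (MvPolynomial (Fin n) K),
      (∀ j, δ (φ j) = 0) → δ = 0)
    {d : ℕ} (hd : d ≠ 0) (hφ : ∀ j, (φ j).IsHomogeneous d)
    {u : Fin n → MvPolynomial (Fin n) K} (hu : ((pencilMatrix c).map (aeval φ)).mulVec u = 0)
    (i k : Fin n) : u i * X k = u k * X i := by
  obtain ⟨l, hl⟩ : ∃ l, φ l ≠ 0 := by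
    by_contra! h
    have h1 := hδφ (pderiv i) fun j => by rw [h j, map_zero]
    have h2 := congrArg (fun δ => δ (X i)) h1
    simp at h2
  let ψ : Fin (n + 1) → MvPolynomial (Fin n) K := fun j => mkDerivation K u (φ j)
  have hψrel : ∀ k, ∑ j, ψ j * pderiv k (c j) = 0 := by
    intro k
    have h1 := congrArg (mkDerivation K u) (hrel k)
    simp only [map_sum, Derivation.leibniz, map_zero, Finset.sum_add_distrib, smul_eq_mul] at h1
    have h2 := congrFun hu k
    rw [map_pencilMatrix_mulVec] at h2
    have h3 : ∑ j, φ j * mkDerivation K u (pderiv k (c j)) = 0 := by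
      rw [← Pi.zero_apply (M := fun _ => MvPolynomial (Fin n) K) k, ← h2]
      refine Finset.sum_congr rfl fun j _ => ?_
      rw [mkDerivation_eq_sum]
      congr 1
      exact Finset.sum_congr rfl fun i _ => by
        rw [pderiv_comm, ← C_secondDerivative hc, algebraMap_eq, mul_comm]
    rw [h3, zero_add] at h1
    rw [← h1]
    exact Finset.sum_congr rfl fun j _ => mul_comm _ _
  let M : Matrix (Fin n) (Fin (n + 1)) (MvPolynomial (Fin n) K) :=
    Matrix.of fun k j => pderiv k (c j)
  have hprop : ∀ j, φ l * ψ j = ψ l * φ j := by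
    refine mul_eq_mul_of_mulVec_eq_zero (M := M) (fun v hv => ?_) (funext fun k => ?_)
      (funext fun k => ?_) hl
    · exact eq_zero_of_sum_mul_pderiv_eq_zero hδc fun j => congrFun hv j
    · rw [Pi.zero_apply, ← hrel k, Matrix.mulVec, dotProduct]
      exact Finset.sum_congr rfl fun j _ => mul_comm _ _
    · rw [Pi.zero_apply, ← hψrel k, Matrix.mulVec, dotProduct]
      exact Finset.sum_congr rfl fun j _ => mul_comm _ _
  have hzero := eq_zero_of_sum_mul_pderiv_eq_zero hδφ
    (u := fun k => (d : MvPolynomial (Fin n) K) * φ l * u k - ψ l * X k) fun j => by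
      have h1 : ∑ k, u k * pderiv k (φ j) = ψ j := (mkDerivation_eq_sum u (φ j)).symm
      have h2 := (hφ j).sum_X_mul_pderiv
      calc _ = (d : MvPolynomial (Fin n) K) * φ l * ∑ k, u k * pderiv k (φ j)
            - ψ l * ∑ k, X k * pderiv k (φ j) := by
              rw [Finset.mul_sum, Finset.mul_sum, ← Finset.sum_sub_distrib]
              exact Finset.sum_congr rfl fun k _ => by ring
        _ = 0 := by
          rw [h1, h2, nsmul_eq_mul]
          linear_combination (d : MvPolynomial (Fin n) K) * hprop j
  have hdl : (d : MvPolynomial (Fin n) K) * φ l ≠ 0 := mul_ne_zero (by exact_mod_cast hd) hl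
  refine mul_left_cancel₀ hdl ?_
  have hi := congrFun hzero i
  have hk := congrFun hzero k
  simp only [Pi.zero_apply] at hi hk
  linear_combination (X k) * hi - (X i) * hk

/-- A kernel vector may be divided by `h` as long as all its entries allow it; the multiplicity of
`h` in one nonzero entry bounds the number of divisions. The result remains nonzero modulo `h`. -/
theorem exists_mulVec_eq_zero_not_dvd {A m : Type*} [CommRing A] [IsDomain A] [WfDvdMonoid A]
    [Fintype m] [DecidableEq m]
    {M : Matrix m m A} (hM : M.det = 0) {h : A} (hh : Prime h) :
    ∃ w, M.mulVec w = 0 ∧ ∃ i, ¬ h ∣ w i := by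
  obtain ⟨w, hw0, hw⟩ := Matrix.exists_mulVec_eq_zero_iff.2 hM
  obtain ⟨i, hi⟩ := Function.ne_iff.1 hw0
  obtain ⟨k, hk⟩ := FiniteMultiplicity.of_not_isUnit hh.not_isUnit hi
  induction k generalizing w with
  | zero => exact ⟨w, hw, i, by simpa using hk⟩
  | succ k ih =>
    by_cases hdvd : ∀ j, h ∣ w j
    · choose v hv using hdvd
      have hwv : w = h • v := funext hv
      refine ih v ?_ ?_ ?_ ?_
      · rintro rfl; exact hw0 (by rw [hwv, smul_zero])
      · rw [hwv, Matrix.mulVec_smul] at hw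
        exact (smul_eq_zero.1 hw).resolve_left hh.ne_zero
      · intro h0; exact hi (by rw [hv i, h0]; simp)
      · rintro ⟨r, hr⟩
        exact hk ⟨r, by rw [hv i, hr]; ring⟩
    · push Not at hdvd
      exact ⟨w, hw, hdvd⟩

theorem det_pencilMatrix_ne_zero (hc : ∀ j, (c j).IsHomogeneous 2)
    (hrel : ∀ k, ∑ j, φ j * pderiv k (c j) = 0)
    (hδc : ∀ δ : Derivation K (MvPolynomial (Fin n) K) (MvPolynomial (Fin n) K),
      (∀ j, δ (c j) = 0) → δ = 0)
    (hδφ : ∀ δ : Derivation K (MvPolynomial (Fin n) K) (MvPolynomial (Fin n) K),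
      (∀ j, δ (φ j) = 0) → δ = 0)
    {d : ℕ} (hd : d ≠ 0) (hφ : ∀ j, (φ j).IsHomogeneous d)
    {h : MvPolynomial (Fin (n + 1)) K} (hh : Prime h)
    (hker : RingHom.ker (aeval φ : MvPolynomial (Fin (n + 1)) K →ₐ[K] _) = Ideal.span {h}) :
    (pencilMatrix c).det ≠ 0 := by
  intro hdet
  obtain ⟨w, hw, l, hl⟩ := exists_mulVec_eq_zero_not_dvd hdet hh
  have hbl : aeval φ (w l) ≠ 0 := fun h0 => hl (by
    rw [← Ideal.mem_span_singleton, ← hker]; exact h0)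
  have hb : ((pencilMatrix c).map (aeval φ)).mulVec (fun i => aeval φ (w i)) = 0 := by
    funext k
    have := congrArg (aeval φ) (congrFun hw k)
    simpa [Matrix.mulVec, dotProduct] using this
  have hpar := mul_X_eq_of_map_pencilMatrix_mulVec_eq_zero hc hrel hδc hδφ hd hφ hb
  have hc0 : ∀ j, c j = 0 := by
    intro j
    have h1 := congrArg (aeval φ) (sum_secondDerivative_mul_eq_zero hw j)
    simp only [map_sum, map_mul, aeval_C, algebraMap_eq, map_zero] at h1
    -- With `b = w(φ)`, the proportionality `b_k x_l = b_l x_k` turns `x_l² bᵀ A_j b = 0` into `b_l²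
    -- xᵀ A_j x = 0`.
    have h2 : (aeval φ (w l)) ^ 2 * (2 * c j) = 0 := by
      rw [← sum_sum_secondDerivative hc j, ← mul_zero ((X l : MvPolynomial (Fin n) K) ^ 2), ← h1]
      simp only [Finset.mul_sum]
      refine Finset.sum_congr rfl fun k _ => Finset.sum_congr rfl fun i _ => ?_
      linear_combination (C (secondDerivative c k i j) * aeval φ (w l) * X i) * hpar l k +
        (C (secondDerivative c k i j) * aeval φ (w k) * X l) * hpar l i
    exact ((mul_eq_zero.1 h2).resolve_left (pow_ne_zero _ hbl) |> mul_eq_zero.1).resolve_left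
      two_ne_zero
  have h1 := hδc (pderiv l) fun j => by rw [hc0 j, map_zero]
  have h2 := congrArg (fun δ => δ (X l)) h1
  simp at h2

end Nondegenerate

/-! ### The ideal of the polar image. -/

section PolarImage

variable {K : Type*} [Field K]

theorem eval_aeval_eq {ι τ : Type*} (ψ : ι → MvPolynomial τ K) (v : τ → K) (F : MvPolynomial ι K) :
    eval v (aeval ψ F) = eval (fun i => eval v (ψ i)) F := by
  induction F using MvPolynomial.induction_on with
  | C a => simp
  | add p q hp hq => simp only [map_add, hp, hq]
  | mul_X p i hp => simp only [map_mul, hp, aeval_X, eval_X]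

theorem exists_eq_smul_of_mem_submodule {ι : Type*} {p : Projectivization K (ι → K)} {v w : ι → K}
    (hv : v ∈ p.submodule) (hv0 : v ≠ 0) (hw : w ∈ p.submodule) : ∃ t : K, w = t • v := by
  rw [p.submodule_eq] at hv hw
  obtain ⟨a, rfl⟩ := Submodule.mem_span_singleton.1 hv
  obtain ⟨b, rfl⟩ := Submodule.mem_span_singleton.1 hw
  have ha : a ≠ 0 := by rintro rfl; exact hv0 (zero_smul _ _)
  exact ⟨b / a, by rw [smul_smul, div_mul_cancel₀ _ ha]⟩

theorem mem_submodule_mk {ι : Type*} {v : ι → K} (hv : v ≠ 0) :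
    v ∈ (Projectivization.mk K v hv).submodule := by
  rw [Projectivization.submodule_mk]; exact Submodule.mem_span_singleton_self v

theorem gradient_smul {N d : ℕ} {f : MvPolynomial (Fin (N + 1)) K} (hf : f.IsHomogeneous d) (t : K)
    (v : Fin (N + 1) → K) : gradient f (t • v) = t ^ (d - 1) • gradient f v :=
  funext fun _ => eval_smul_of_isHomogeneous hf.pderiv t v

theorem mem_vanishingIdeal_polarImage [IsAlgClosed K] {N : ℕ} {f : MvPolynomial (Fin (N + 1)) K}
    (hf : f.IsHomogeneous 3) {i : Fin (N + 1)} (hi : pderiv i f ≠ 0)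
    {F : MvPolynomial (Fin (N + 1)) K} :
    F ∈ vanishingIdeal (polarImage f) ↔ aeval (fun j => pderiv j f) F = 0 := by
  have : Infinite K := IsAlgClosed.instInfinite
  rw [polarImage, vanishingIdeal_closure]
  constructor
  · intro hF
    -- The factor `pderiv i f` takes care of the points where the polar map is undefined.
    have h : aeval (fun i => pderiv i f) F * pderiv i f = 0 := by
      refine MvPolynomial.funext fun v => ?_
      rw [map_mul, eval_aeval_eq, map_zero]
      by_cases hv : gradient f v = 0
      · rw [show eval v (pderiv i f) = 0 from congrFun hv i, mul_zero]
      · have hv0 : v ≠ 0 := by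
          rintro rfl
          refine hv ?_
          have := gradient_smul hf 0 0
          simpa using this
        have := hF (Projectivization.mk K _ hv)
          ⟨Projectivization.mk K v hv0, v, mem_submodule_mk hv0, hv, mem_submodule_mk hv⟩ _
          (mem_submodule_mk hv)
        rw [show eval (fun i => eval v (pderiv i f)) F = 0 from this, zero_mul]
    exact (mul_eq_zero.1 h).resolve_right hi
  · rintro hF q ⟨p, v, -, hv, hq⟩ w hw
    obtain ⟨t, rfl⟩ := exists_eq_smul_of_mem_submodule hq hv hw
    -- The gradient of a cubic is quadratic, so a square root of the scalar places every multiple of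
    -- `∇f(v)` among the gradients.
    obtain ⟨s, rfl⟩ := IsAlgClosed.exists_pow_nat_eq t (n := 2) two_pos
    have h := eval_aeval_eq (fun i => pderiv i f) (s • v) F
    rw [hF, map_zero] at h
    rw [show s ^ 2 • gradient f v = gradient f (s • v) from (gradient_smul hf s v).symm]
    exact h.symm

end PolarImage

/-! ### Tangent spaces and the dual variety of a hypersurface. -/

section DualOfHypersurface

variable {K : Type*} [Field K] {N : ℕ}

theorem differential_apply {ι : Type*} [Fintype ι] (F : MvPolynomial ι K) (v w : ι → K) :
    differential F v w = ∑ i, eval v (pderiv i F) * w i := by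
  simp [differential]

theorem differential_mul {ι : Type*} [Fintype ι] (F G : MvPolynomial ι K) (v : ι → K) :
    differential (F * G) v = eval v F • differential G v + eval v G • differential F v := by
  ext w
  simp only [differential, Derivation.leibniz, smul_eq_mul, map_add, map_mul, add_smul,
    Finset.sum_add_distrib, mul_smul, Finset.smul_sum]

variable {Z : Set (Projectivization K (Fin (N + 1) → K))} {g : MvPolynomial (Fin (N + 1)) K}
  {d : ℕ}

theorem differential_smul (hg : g.IsHomogeneous d) (t : K) (v : Fin (N + 1) → K) :
    differential g (t • v) = t ^ (d - 1) • differential g v := by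
  ext w
  rw [differential, differential, Finset.smul_sum]
  simp only [eval_smul_of_isHomogeneous hg.pderiv, mul_smul]

theorem tangentSpace_eq_ker_differential (hg : g.IsHomogeneous d)
    (hZ : vanishingIdeal Z = Ideal.span {g}) {z : Projectivization K (Fin (N + 1) → K)}
    (hz : z ∈ Z) : tangentSpace Z z = LinearMap.ker (differential g z.rep) := by
  have hgZ : g ∈ vanishingIdeal Z := by rw [hZ]; exact Ideal.mem_span_singleton_self g
  refine le_antisymm ?_ ?_
  · exact (iInf₂_le g hgZ).trans (iInf₂_le _ (rep_mem_submodule z))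
  · refine le_iInf₂ fun F hF => le_iInf₂ fun v hv => ?_
    rw [hZ] at hF
    obtain ⟨q, rfl⟩ := Ideal.mem_span_singleton.1 hF
    obtain ⟨t, rfl⟩ := exists_eq_smul_of_mem_submodule (rep_mem_submodule z) z.rep_nonzero hv
    intro w hw
    rw [LinearMap.mem_ker] at hw ⊢
    rw [differential_mul, hgZ z hz _ hv, zero_smul, zero_add, differential_smul hg]
    simp [hw]

theorem mem_regularLocus_iff (hg : g.IsHomogeneous d) (hZ : vanishingIdeal Z = Ideal.span {g})
    (hdim : dim Z + 1 = (N : WithBot ℕ∞)) {z : Projectivization K (Fin (N + 1) → K)} :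
    z ∈ regularLocus Z ↔ z ∈ Z ∧ gradient g z.rep ≠ 0 := by
  refine and_congr_right fun hz => ?_
  have hgrad : gradient g z.rep = 0 ↔ differential g z.rep = 0 := by
    constructor
    · intro h
      ext w
      rw [differential]
      simp [show ∀ i, eval z.rep (pderiv i g) = 0 from congrFun h]
    · intro h
      funext i
      have := LinearMap.congr_fun h (Pi.single i 1)
      simpa [differential_apply, Pi.single_apply, Perazzo.gradient] using this
  rw [tangentSpace_eq_ker_differential hg hZ hz, hdim, Ne, hgrad]
  have hrk := LinearMap.finrank_range_add_finrank_ker (differential g z.rep)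
  rw [Module.finrank_pi, Fintype.card_fin] at hrk
  constructor
  · intro h h0
    have h' : Module.finrank K (LinearMap.ker (differential g z.rep)) = N := by exact_mod_cast h
    rw [h0, LinearMap.range_zero, finrank_bot] at hrk
    rw [h0] at h'
    omega
  · intro h
    have h1 : LinearMap.range (differential g z.rep) = ⊤ :=
      LinearMap.range_eq_top.2 (LinearMap.surjective h)
    rw [h1, finrank_top, Module.finrank_self] at hrk
    have : Module.finrank K (LinearMap.ker (differential g z.rep)) = N := by omega
    rw [this]

theorem mem_dualSpace_ker_differential {v a : Fin (N + 1) → K} :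
    a ∈ dualSpace (LinearMap.ker (differential g v)) ↔ ∃ t : K, a = t • gradient g v := by
  constructor
  · intro ha
    let α : (Fin (N + 1) → K) →ₗ[K] K := ∑ i, a i • LinearMap.proj i
    have hα : ∀ w, α w = ∑ i, a i * w i := fun w => by simp [α]
    have h := mem_span_of_iInf_ker_le_ker (L := fun _ : Unit => differential g v) (K := α)
      (by
        rw [iInf_const]
        exact fun w hw => (hα w).trans (ha w hw))
    rw [Set.range_const, Submodule.mem_span_singleton] at h
    obtain ⟨t, ht⟩ := h
    refine ⟨t, funext fun i => ?_⟩
    have := LinearMap.congr_fun ht (Pi.single i 1)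
    rw [hα] at this
    simpa [differential_apply, Pi.single_apply, Perazzo.gradient] using this.symm
  · rintro ⟨t, rfl⟩ w hw
    rw [LinearMap.mem_ker, differential_apply] at hw
    simp only [Pi.smul_apply, smul_eq_mul, mul_assoc, ← Finset.mul_sum]
    rw [show ∑ i, gradient g v i * w i = 0 from hw, mul_zero]

/-- At a smooth point the dual of the tangent space is the single point `∇g`. Singular points are
discarded by multiplying by `pderiv i g`, which lies outside the prime ideal `I(Z)`. -/
theorem mem_vanishingIdeal_dualVariety [Infinite K] (hg : g.IsHomogeneous d)
    (hZ : vanishingIdeal Z = Ideal.span {g}) (hprime : (vanishingIdeal Z).IsPrime)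
    (hdim : dim Z + 1 = (N : WithBot ℕ∞)) {i : Fin (N + 1)} (hi : pderiv i g ∉ vanishingIdeal Z)
    {P : MvPolynomial (Fin (N + 1)) K} {n : ℕ} (hP : P.IsHomogeneous n) :
    P ∈ vanishingIdeal (dualVariety Z) ↔ aeval (fun i => pderiv i g) P ∈ vanishingIdeal Z := by
  rw [dualVariety, vanishingIdeal_closure]
  have hhom : (aeval (fun i => pderiv i g) P).IsHomogeneous ((d - 1) * n) :=
    hP.aeval _ fun i => hg.pderiv
  constructor
  · intro hPZ
    refine (hprime.mem_or_mem (x := aeval (fun i => pderiv i g) P) (y := pderiv i g)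
      fun z hz => ?_).resolve_right hi
    rw [vanishesAt_iff (hhom.mul hg.pderiv), map_mul, eval_aeval_eq]
    by_cases h0 : gradient g z.rep = 0
    · rw [show eval z.rep (pderiv i g) = 0 from congrFun h0 i, mul_zero]
    · have hreg := (mem_regularLocus_iff hg hZ hdim).2 ⟨hz, h0⟩
      have hmem : Projectivization.mk K _ h0 ∈
          ⋃ z ∈ regularLocus Z, linearSpace (dualSpace (tangentSpace Z z)) := by
        refine Set.mem_iUnion₂.2 ⟨z, hreg, ?_⟩
        change Projectivization.submodule _ ≤ _
        rw [Projectivization.submodule_mk, Submodule.span_singleton_le_iff_mem,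
          tangentSpace_eq_ker_differential hg hZ hz, mem_dualSpace_ker_differential]
        exact ⟨1, (one_smul _ _).symm⟩
      rw [show eval (fun i => eval z.rep (pderiv i g)) P = 0 from
        hPZ _ hmem _ (mem_submodule_mk h0), zero_mul]
  · intro hPZ q hq w hw
    obtain ⟨z, hreg, hqz⟩ := Set.mem_iUnion₂.1 hq
    have hz := ((mem_regularLocus_iff hg hZ hdim).1 hreg).1
    have hw' := hqz hw
    rw [tangentSpace_eq_ker_differential hg hZ hz, mem_dualSpace_ker_differential] at hw'
    obtain ⟨t, rfl⟩ := hw'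
    have h0 := hPZ z hz _ (rep_mem_submodule z)
    rw [eval_aeval_eq] at h0
    rw [eval_smul_of_isHomogeneous hP, show eval (gradient g z.rep) P = 0 from h0, mul_zero]

end DualOfHypersurface

/-! ### Homogeneous ideals and elimination of variables. -/

section HomogeneousIdeals

variable {K : Type*} [Field K]

theorem aeval_mul_of_isHomogeneous {ι A : Type*} [CommRing A] [Algebra K A]
    {F : MvPolynomial ι K} {n : ℕ} (hF : F.IsHomogeneous n) (w : A) (φ : ι → A) :
    aeval (fun j => w * φ j) F = w ^ n * aeval φ F := by
  rw [aeval_def, aeval_def, eval₂_eq, eval₂_eq, Finset.mul_sum]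
  refine Finset.sum_congr rfl fun m hm => ?_
  have hd : ∑ i ∈ m.support, m i = n := by
    have := hF (mem_support_iff.1 hm)
    rw [← this, Finsupp.weight_apply, Finsupp.sum]
    simp
  simp only [mul_pow, Finset.prod_mul_distrib]
  rw [Finset.prod_pow_eq_pow_sum, hd]
  ring

theorem homogeneousComponent_mem_ker_aeval {ι τ : Type*} {φ : ι → MvPolynomial τ K} {d : ℕ}
    (hd : d ≠ 0) (hφ : ∀ j, (φ j).IsHomogeneous d) {F : MvPolynomial ι K} (hF : aeval φ F = 0)
    (n : ℕ) : aeval φ (homogeneousComponent n F) = 0 := by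
  by_cases hn : n < F.totalDegree + 1
  · have h := congrArg (homogeneousComponent (d * n)) hF
    rw [← sum_homogeneousComponent F, map_sum, map_sum, map_zero] at h
    rw [Finset.sum_eq_single n] at h
    · rwa [homogeneousComponent_of_mem
        ((homogeneousComponent_isHomogeneous n F).aeval φ hφ), if_pos rfl] at h
    · intro m _ hmn
      rw [homogeneousComponent_of_mem ((homogeneousComponent_isHomogeneous m F).aeval φ hφ),
        if_neg fun h => hmn (Nat.eq_of_mul_eq_mul_left (Nat.pos_of_ne_zero hd) h).symm]
    · intro h; exact absurd (Finset.mem_range.2 hn) h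
  · rw [homogeneousComponent_eq_zero _ _ (by omega), map_zero]

theorem ideal_le_of_forall_isHomogeneous {ι : Type*} {I J : Ideal (MvPolynomial ι K)}
    (hI : ∀ F ∈ I, ∀ n, homogeneousComponent n F ∈ I)
    (h : ∀ (n : ℕ) (F : MvPolynomial ι K), F.IsHomogeneous n → F ∈ I → F ∈ J) : I ≤ J := by
  intro F hF
  rw [← sum_homogeneousComponent F]
  exact sum_mem fun n _ => h n _ (homogeneousComponent_isHomogeneous n F) (hI F hF n)

/-- The top component of `g` is a multiple of `g` of the same degree, hence a scalar multiple. -/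
theorem isHomogeneous_of_span_singleton {ι : Type*} {I : Ideal (MvPolynomial ι K)}
    (hI : ∀ F ∈ I, ∀ n, homogeneousComponent n F ∈ I) {g : MvPolynomial ι K} (hg : g ≠ 0)
    (hIg : I = Ideal.span {g}) : g.IsHomogeneous g.totalDegree := by
  have h1 : homogeneousComponent g.totalDegree g ∈ I :=
    hI g (hIg ▸ Ideal.mem_span_singleton_self g) _
  rw [hIg] at h1
  obtain ⟨q, hq⟩ := Ideal.mem_span_singleton.1 h1
  have hhom := homogeneousComponent_isHomogeneous g.totalDegree g
  have hne : homogeneousComponent g.totalDegree g ≠ 0 := by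
    intro h0
    obtain ⟨m, hm, hmd⟩ := Finset.exists_mem_eq_sup g.support (support_nonempty.2 hg)
      fun s => s.sum fun _ e => e
    have hdeg : m.degree = g.totalDegree := by
      rw [totalDegree, hmd, Finsupp.degree_apply]; rfl
    have h2 := congrArg (coeff m) h0
    rw [coeff_homogeneousComponent, if_pos hdeg, coeff_zero] at h2
    exact mem_support_iff.1 hm h2
  have hq0 : q ≠ 0 := by rintro rfl; rw [mul_zero] at hq; exact hne hq
  have hdeg := hhom.totalDegree hne
  rw [hq, totalDegree_mul_of_isDomain hg hq0] at hdeg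
  obtain ⟨a, rfl⟩ : ∃ a, q = C a := ⟨_, totalDegree_eq_zero_iff_eq_C.1 (by omega)⟩
  have ha : a ≠ 0 := fun h => hq0 (by rw [h, C_0])
  have h3 := hhom.C_mul a⁻¹
  rwa [hq, mul_left_comm, ← C_mul, inv_mul_cancel₀ ha, C_1, mul_one] at h3

theorem exists_pderiv_ne_zero [CharZero K] {ι : Type*} [Fintype ι] {g : MvPolynomial ι K} {d : ℕ}
    (hg : g.IsHomogeneous d) (hd : d ≠ 0) (hg0 : g ≠ 0) : ∃ i, pderiv i g ≠ 0 := by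
  by_contra! h
  have h1 := hg.sum_X_mul_pderiv
  simp only [h, mul_zero, Finset.sum_const_zero, nsmul_eq_mul] at h1
  exact mul_ne_zero (by exact_mod_cast hd) hg0 h1.symm

theorem exists_pderiv_notMem_span [CharZero K] {ι : Type*} [Fintype ι] {g : MvPolynomial ι K}
    {d : ℕ} (hg : g.IsHomogeneous d) (hd : d ≠ 0) (hg0 : g ≠ 0) :
    ∃ i, pderiv i g ∉ Ideal.span {g} := by
  obtain ⟨i, hi⟩ := exists_pderiv_ne_zero hg hd hg0
  refine ⟨i, fun h => ?_⟩
  obtain ⟨q, hq⟩ := Ideal.mem_span_singleton.1 h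
  have hq0 : q ≠ 0 := by rintro rfl; rw [mul_zero] at hq; exact hi hq
  have h1 := (hg.pderiv (i := i)).totalDegree hi
  rw [hq, totalDegree_mul_of_isDomain hg0 hq0, hg.totalDegree hg0] at h1
  omega

theorem sub_rename_killCompl_mem {ι τ : Type*} {e : τ → ι} (he : Function.Injective e)
    {I : Ideal (MvPolynomial ι K)} (hI : ∀ i, i ∉ Set.range e → X i ∈ I) (F : MvPolynomial ι K) :
    F - rename e (killCompl he F) ∈ I := by
  have h : (Ideal.Quotient.mkₐ K I).comp ((rename e).comp (killCompl he)) =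
      Ideal.Quotient.mkₐ K I := by
    refine algHom_ext fun i => ?_
    by_cases hi : i ∈ Set.range e
    · obtain ⟨j, rfl⟩ := hi
      have := killCompl_rename_app he (X j : MvPolynomial τ K)
      rw [rename_X] at this
      simp [this]
    · have h0 : killCompl he (X i : MvPolynomial ι K) = 0 := by
        rw [killCompl, aeval_X, dif_neg hi]
      simp only [AlgHom.comp_apply, h0, map_zero]
      exact (Ideal.Quotient.eq_zero_iff_mem.2 (hI i hi)).symm
  exact Ideal.Quotient.eq.1 (AlgHom.congr_fun h F).symm

/-- Setting the variables outside the range of `e` to zero changes a polynomial by an element of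
`I`, so `I` is determined by its trace on the remaining variables. -/
theorem eq_comap_killCompl {ι τ : Type*} {e : τ → ι} (he : Function.Injective e)
    {I : Ideal (MvPolynomial ι K)} (hI : ∀ i, i ∉ Set.range e → X i ∈ I) :
    I = (I.comap (rename (R := K) e)).comap (killCompl he) := by
  ext F
  rw [Ideal.mem_comap, Ideal.mem_comap]
  have h := sub_rename_killCompl_mem he hI F
  exact ⟨fun hF => by simpa using sub_mem hF h, fun hF => by simpa using add_mem h hF⟩

theorem exists_rename_eq_of_dvd_rename {ι τ : Type*} {e : τ → ι} (he : Function.Injective e)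
    {G : MvPolynomial τ K} (hG : G ≠ 0) {g : MvPolynomial ι K} (h : g ∣ rename e G) :
    ∃ g₀, rename e g₀ = g := by
  classical
  obtain ⟨q, hq⟩ := h
  have hG' : rename e G ≠ 0 := fun h0 => hG (rename_injective e he (by rw [h0, map_zero]))
  have hg : g ≠ 0 := by rintro rfl; exact hG' (by rw [hq, zero_mul])
  have hq0 : q ≠ 0 := by rintro rfl; exact hG' (by rw [hq, mul_zero])
  refine exists_rename_eq_of_vars_subset_range g e he fun i hi => ?_
  rw [Finset.mem_coe, mem_vars_iff_degreeOf_ne_zero] at hi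
  have h1 : i ∈ (rename e G).vars := by
    rw [mem_vars_iff_degreeOf_ne_zero, hq, degreeOf_mul_eq hg hq0]; omega
  have := vars_rename e G h1
  rw [Finset.mem_image] at this
  obtain ⟨j, -, rfl⟩ := this
  exact ⟨j, rfl⟩

theorem comap_rename_span_rename {ι τ : Type*} {e : τ → ι} (he : Function.Injective e)
    (g : MvPolynomial τ K) :
    (Ideal.span {rename e g}).comap (rename (R := K) e) = Ideal.span {g} := by
  ext r
  rw [Ideal.mem_comap, Ideal.mem_span_singleton, Ideal.mem_span_singleton]
  constructor
  · rintro ⟨q, hq⟩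
    refine ⟨killCompl he q, ?_⟩
    have := congrArg (killCompl he) hq
    rwa [map_mul, killCompl_rename_app, killCompl_rename_app] at this
  · exact fun h => map_dvd _ h

end HomogeneousIdeals

/-! ### Equations of the polar image and of its dual. -/

section Reduction

variable {K : Type*} [Field K] [IsAlgClosed K] [CharZero K] {N n : ℕ}
  {f : MvPolynomial (Fin (N + 1)) K} {head : Fin (n + 1) → Fin (N + 1)} {tail : Fin n → Fin (N + 1)}
  {c : Fin (n + 1) → MvPolynomial (Fin n) K}

theorem isPrime_vanishingIdeal_polarImage (hf : f.IsHomogeneous 3) (hf0 : f ≠ 0) :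
    (vanishingIdeal (polarImage f)).IsPrime := by
  obtain ⟨i, hi⟩ := exists_pderiv_ne_zero hf (by norm_num) hf0
  have : vanishingIdeal (polarImage f) = RingHom.ker (aeval fun j => pderiv j f) :=
    Ideal.ext fun F => mem_vanishingIdeal_polarImage hf hi
  rw [this]
  exact RingHom.ker_isPrime _

/-- If the polar image is a hypersurface and `n + 1` partial derivatives of `f` depend only on `n`
variables, then the equation of the polar image is the relation between these derivatives. -/
theorem exists_equation_polarImage (hf : f.IsHomogeneous 3) (hf0 : f ≠ 0)
    (hhead : Function.Injective head) (htail : Function.Injective tail)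
    (hfc : ∀ j, pderiv (head j) f = rename tail (c j))
    (hcodim : dim (polarImage f) + 1 = (N : WithBot ℕ∞)) :
    ∃ (d : ℕ) (g : MvPolynomial (Fin (n + 1)) K), d ≠ 0 ∧ g.IsHomogeneous d ∧ g ≠ 0 ∧
      vanishingIdeal (polarImage f) = Ideal.span {rename head g} ∧
      RingHom.ker (aeval c : MvPolynomial (Fin (n + 1)) K →ₐ[K] _) = Ideal.span {g} := by
  obtain ⟨i, hi⟩ := exists_pderiv_ne_zero hf (by norm_num) hf0
  have hprime := isPrime_vanishingIdeal_polarImage hf hf0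
  have hcomap : (vanishingIdeal (polarImage f)).comap (rename (R := K) head) =
      RingHom.ker (aeval c : MvPolynomial (Fin (n + 1)) K →ₐ[K] _) := by
    ext r
    rw [Ideal.mem_comap, mem_vanishingIdeal_polarImage hf hi, RingHom.mem_ker, aeval_rename,
      show ((fun j => pderiv j f) ∘ head) = fun j => rename tail (c j) from funext hfc,
      ← comp_aeval_apply, map_eq_zero_iff _ (rename_injective _ htail)]
  obtain ⟨G, hG, hG0⟩ := Submodule.exists_mem_ne_zero_of_ne_bot (ker_aeval_ne_bot c)
  have hGI : rename head G ∈ vanishingIdeal (polarImage f) := by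
    rw [← Ideal.mem_comap, hcomap]; exact hG
  obtain ⟨g', hg', hspan⟩ := exists_prime_span_of_dim_add_one hcodim (AlgHom.id K _)
    (fun F => ⟨F, by simp⟩) (by exact hprime.comap (RingHom.id _)) fun h => by
      have : rename head G ∈ (vanishingIdeal (polarImage f)).comap (AlgHom.id K _) := hGI
      rw [h] at this
      exact hG0 (rename_injective _ hhead (by rw [map_zero]; exact this))
  replace hspan : vanishingIdeal (polarImage f) = Ideal.span {g'} := hspan
  obtain ⟨g, rfl⟩ := exists_rename_eq_of_dvd_rename hhead hG0
    (Ideal.mem_span_singleton.1 (hspan ▸ hGI))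
  have hhom := isHomogeneous_of_span_singleton
    (fun F hF n => homogeneousComponent_mem_vanishingIdeal hF n) hg'.ne_zero hspan
  refine ⟨_, g, fun h0 => ?_, (IsHomogeneous.rename_isHomogeneous_iff hhead).1 hhom, ?_, hspan, ?_⟩
  · rw [totalDegree_eq_zero_iff_eq_C] at h0
    have hne := hg'.ne_zero
    rw [h0] at hne
    refine hg'.not_isUnit ?_
    rw [h0]
    exact (isUnit_iff_ne_zero.2 fun h => hne (by rw [h, C_0])).map C
  · rintro rfl; exact hg'.ne_zero (map_zero _)
  · rw [← hcomap, hspan, comap_rename_span_rename hhead]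

theorem exists_equation_dualVariety (hn : n ≠ 0) (hf : f.IsHomogeneous 3) (hf0 : f ≠ 0)
    (hhead : Function.Injective head) (htail : Function.Injective tail)
    (hc : ∀ j, (c j).IsHomogeneous 2)
    (hfc : ∀ j, pderiv (head j) f = rename tail (c j))
    (hcodim : dim (polarImage f) + 1 = (N : WithBot ℕ∞))
    (hdual : dim (dualVariety (polarImage f)) + 1 = (n : WithBot ℕ∞)) :
    ∃ h : MvPolynomial (Fin (n + 1)) K, Prime h ∧
      vanishingIdeal (dualVariety (polarImage f)) = (Ideal.span {h}).comap (killCompl hhead) ∧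
      (pencilMatrix c).det ≠ 0 ∧ h ∣ (pencilMatrix c).det := by
  obtain ⟨d, g, hd, hg, hg0, hZ, hker⟩ :=
    exists_equation_polarImage hf hf0 hhead htail hfc hcodim
  have hprime := isPrime_vanishingIdeal_polarImage hf hf0
  have hδc := derivation_eq_zero_of_ker_aeval_eq_span hker
  obtain ⟨l, hl⟩ : ∃ l, c l ≠ 0 := by
    by_contra! h
    have h1 := hδc (pderiv ⟨0, Nat.pos_of_ne_zero hn⟩) fun j => by rw [h j, map_zero]
    have h2 := congrArg (fun δ => δ (X ⟨0, Nat.pos_of_ne_zero hn⟩)) h1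
    simp at h2
  have hg' : (rename head g).IsHomogeneous d := hg.rename_isHomogeneous
  have hg0' : rename head g ≠ 0 := fun h => hg0 (rename_injective _ hhead (by rw [h, map_zero]))
  obtain ⟨i, hi⟩ := exists_pderiv_notMem_span hg' hd hg0'
  rw [← hZ] at hi
  have hmem : ∀ {P : MvPolynomial (Fin (N + 1)) K} {m : ℕ}, P.IsHomogeneous m →
      (P ∈ vanishingIdeal (dualVariety (polarImage f)) ↔
        aeval (fun i => pderiv i (rename head g)) P ∈ vanishingIdeal (polarImage f)) := fun hP =>
    mem_vanishingIdeal_dualVariety hg' hZ hprime hcodim hi hP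
  -- When `d = 1` the derivatives of `g` are constants. The factor `c l` makes the degree of `φ`
  -- positive without changing its homogeneous relations, so that the kernel of `aeval φ` is a
  -- homogeneous ideal and Euler's formula for `φ` is not void.
  let φ : Fin (n + 1) → MvPolynomial (Fin n) K := fun j => c l * aeval c (pderiv j g)
  have hφ : ∀ j, (φ j).IsHomogeneous (2 + 2 * (d - 1)) := fun j =>
    (hc l).mul (hg.pderiv.aeval c hc)
  have hd' : 2 + 2 * (d - 1) ≠ 0 := by omega
  have hgc : aeval c g = 0 := by
    have : g ∈ RingHom.ker (aeval c : MvPolynomial (Fin (n + 1)) K →ₐ[K] _) := by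
      rw [hker]; exact Ideal.mem_span_singleton_self g
    exact this
  have hrel : ∀ k, ∑ j, φ j * pderiv k (c j) = 0 := by
    intro k
    have h1 := derivation_aeval (pderiv k) c g
    rw [hgc, map_zero] at h1
    simp only [φ, mul_assoc, ← Finset.mul_sum]
    rw [← h1, mul_zero]
  have hQhom : ∀ {r : MvPolynomial (Fin (n + 1)) K} {m : ℕ}, r.IsHomogeneous m →
      (rename head r ∈ vanishingIdeal (dualVariety (polarImage f)) ↔ aeval φ r = 0) := by
    intro r m hr
    rw [hmem hr.rename_isHomogeneous, aeval_rename,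
      show ((fun i => pderiv i (rename head g)) ∘ head) = fun j => rename head (pderiv j g) from
        funext fun j => pderiv_rename hhead j g,
      ← comp_aeval_apply, ← Ideal.mem_comap, hZ, comap_rename_span_rename hhead, ← hker,
      RingHom.mem_ker, comp_aeval_apply, aeval_mul_of_isHomogeneous hr,
      mul_eq_zero, or_iff_right (pow_ne_zero _ hl)]
  have hQ : (vanishingIdeal (dualVariety (polarImage f))).comap (rename (R := K) head) =
      RingHom.ker (aeval φ : MvPolynomial (Fin (n + 1)) K →ₐ[K] _) := by
    refine le_antisymm (ideal_le_of_forall_isHomogeneous (fun F hF m => ?_)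
      fun m r hr h => (hQhom hr).1 h)
      (ideal_le_of_forall_isHomogeneous (fun F hF m => ?_) fun m r hr h => (hQhom hr).2 h)
    · rw [Ideal.mem_comap, rename_homogeneousComponent]
      exact homogeneousComponent_mem_vanishingIdeal hF m
    · exact homogeneousComponent_mem_ker_aeval hd' hφ hF m
  -- `g` involves only head variables, so the other coordinates of `∇g` vanish.
  have hX : ∀ i, i ∉ Set.range head →
      (X i : MvPolynomial (Fin (N + 1)) K) ∈ vanishingIdeal (dualVariety (polarImage f)) := by
    intro i hi
    rw [hmem (isHomogeneous_X K i), aeval_X, pderiv_eq_zero_of_notMem_vars]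
    · exact zero_mem _
    · intro h
      have := vars_rename head g h
      rw [Finset.mem_image] at this
      obtain ⟨j, -, rfl⟩ := this
      exact hi ⟨j, rfl⟩
  obtain ⟨h, hh, hspan⟩ := exists_prime_span_of_dim_add_one hdual (rename head)
    (fun F => ⟨_, sub_rename_killCompl_mem hhead hX F⟩)
    (hQ ▸ RingHom.ker_isPrime _) (hQ ▸ ker_aeval_ne_bot φ)
  have hkerφ := hQ.symm.trans hspan
  refine ⟨h, hh, ?_, ?_, ?_⟩
  · rw [← hspan]; exact eq_comap_killCompl hhead hX
  · exact det_pencilMatrix_ne_zero hc hrel hδc (derivation_eq_zero_of_ker_aeval_eq_span hkerφ)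
      hd' hφ hh hkerφ
  · rw [← Ideal.mem_span_singleton, ← hkerφ]
    exact aeval_det_pencilMatrix hn hc hrel

end Reduction

/-! ### Hilbert function and degree of a hypersurface in a linear subspace. -/

section Degree

variable {K : Type*} [Field K]

theorem finrank_homogeneousSubmodule (m n : ℕ) :
    Module.finrank K (homogeneousSubmodule (Fin (m + 1)) K n) = (n + m).choose m := by
  classical
  rw [homogeneousSubmodule_eq_finsupp_supported,
    (AddMonoidAlgebra.supportedEquivFinsupp (R := K) (S := K)
      {d : Fin (m + 1) →₀ ℕ | d.degree = n}).finrank_eq]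
  have hset : {d : Fin (m + 1) →₀ ℕ | d.degree = n} =
      ((Finset.univ : Finset (Fin (m + 1))).finsuppAntidiag n : Set (Fin (m + 1) →₀ ℕ)) := by
    ext d
    simp [Finset.mem_finsuppAntidiag, Finsupp.degree_eq_sum]
  rw [hset, Module.finrank_finsupp_self]
  simp only [Finset.coe_sort_coe, Fintype.card_coe]
  rw [Finset.card_finsuppAntidiag_nat_eq_choose, Finset.card_univ, Fintype.card_fin,
    show m + 1 + n - 1 = n + m by omega, Nat.choose_symm_add]

theorem exists_isHomogeneous_eq_mul {ι : Type*} {h r : MvPolynomial ι K} {e n : ℕ}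
    (hh : h.IsHomogeneous e) (hr : r.IsHomogeneous (e + n)) (hdvd : h ∣ r) :
    ∃ q : MvPolynomial ι K, q.IsHomogeneous n ∧ r = h * q := by
  obtain ⟨q, rfl⟩ := hdvd
  refine ⟨homogeneousComponent n q, homogeneousComponent_isHomogeneous n q, ?_⟩
  have h1 := homogeneousComponent_of_mem (m := e + n) hr
  rw [if_pos rfl] at h1
  rw [← h1]
  by_cases hn : n < q.totalDegree + 1
  · nth_rewrite 1 [← sum_homogeneousComponent q]
    rw [Finset.mul_sum, map_sum, Finset.sum_eq_single n]
    · rw [homogeneousComponent_of_mem (hh.mul (homogeneousComponent_isHomogeneous n q)),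
        if_pos rfl]
    · intro k _ hk
      rw [homogeneousComponent_of_mem (hh.mul (homogeneousComponent_isHomogeneous k q)),
        if_neg (by omega)]
    · intro hn'; exact absurd (Finset.mem_range.2 hn) hn'
  · nth_rewrite 1 [← sum_homogeneousComponent q]
    rw [homogeneousComponent_eq_zero n q (by omega), mul_zero, Finset.mul_sum, map_sum]
    refine Finset.sum_eq_zero fun k hk => ?_
    rw [Finset.mem_range] at hk
    rw [homogeneousComponent_of_mem (hh.mul (homogeneousComponent_isHomogeneous k q)),
      if_neg (by omega)]

variable {ι : Type*} {m : ℕ} {head : Fin (m + 1) → ι}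

theorem killCompl_isHomogeneous (hhead : Function.Injective head) {F : MvPolynomial ι K} {n : ℕ}
    (hF : F.IsHomogeneous n) : (killCompl hhead F).IsHomogeneous n := by
  have h := hF.aeval (n := 1) (killCompl hhead ∘ X) fun i => by
    by_cases hi : i ∈ Set.range head
    · obtain ⟨j, rfl⟩ := hi
      have := killCompl_rename_app hhead (X j : MvPolynomial (Fin (m + 1)) K)
      rw [rename_X] at this
      rw [Function.comp_apply, this]
      exact isHomogeneous_X _ _
    · rw [Function.comp_apply, killCompl, aeval_X, dif_neg hi]
      exact isHomogeneous_zero _ _ _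
  rwa [← aeval_unique, one_mul] at h

/-- In degree `e + n` the coordinate ring is the quotient of the forms in `m + 1` variables by `h`
times the forms of degree `n`. -/
theorem hilbertFunction_add_choose (hhead : Function.Injective head)
    {V : Set (Projectivization K (ι → K))} {h : MvPolynomial (Fin (m + 1)) K} (hh0 : h ≠ 0)
    {e : ℕ} (hh : h.IsHomogeneous e)
    (hV : vanishingIdeal V = (Ideal.span {h}).comap (killCompl hhead)) (n : ℕ) :
    hilbertFunction V (e + n) + (n + m).choose m = (e + n + m).choose m := by
  let T : homogeneousSubmodule (Fin (m + 1)) K (e + n) →ₗ[K] MvPolynomial ι K ⧸ vanishingIdeal V :=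
    ((Ideal.Quotient.mkₐ K (vanishingIdeal V)).toLinearMap ∘ₗ (rename head).toLinearMap) ∘ₗ
      Submodule.subtype _
  have hTker : ∀ r, T r = 0 ↔ h ∣ (r : MvPolynomial (Fin (m + 1)) K) := by
    intro r
    rw [← Ideal.mem_span_singleton]
    change Ideal.Quotient.mk _ (rename head (r : MvPolynomial (Fin (m + 1)) K)) = 0 ↔ _
    rw [Ideal.Quotient.eq_zero_iff_mem, hV, Ideal.mem_comap, killCompl_rename_app]
  have hX : ∀ i, i ∉ Set.range head → (X i : MvPolynomial ι K) ∈ vanishingIdeal V := by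
    intro i hi
    rw [hV, Ideal.mem_comap, killCompl, aeval_X, dif_neg hi]
    exact zero_mem _
  have hrange : (homogeneousSubmodule ι K (e + n)).map
      (Ideal.Quotient.mkₐ K (vanishingIdeal V)).toLinearMap = LinearMap.range T := by
    ext x
    constructor
    · rintro ⟨F, hF, rfl⟩
      refine ⟨⟨killCompl hhead F, killCompl_isHomogeneous hhead hF⟩, ?_⟩
      exact (Ideal.Quotient.eq.2 (sub_rename_killCompl_mem hhead hX F)).symm
    · rintro ⟨r, rfl⟩
      exact ⟨rename head r, IsHomogeneous.rename_isHomogeneous r.2, rfl⟩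
  have hkermap : (LinearMap.ker T).map (Submodule.subtype _) =
      (homogeneousSubmodule (Fin (m + 1)) K n).map (LinearMap.mulLeft K h) := by
    ext r
    constructor
    · rintro ⟨r, hr, rfl⟩
      obtain ⟨q, hq, hrq⟩ := exists_isHomogeneous_eq_mul hh r.2 ((hTker r).1 hr)
      exact ⟨q, hq, hrq.symm⟩
    · rintro ⟨q, hq, rfl⟩
      exact ⟨⟨h * q, hh.mul hq⟩, (hTker _).2 (dvd_mul_right _ _), rfl⟩
  have hker : Module.finrank K (LinearMap.ker T) = (n + m).choose m := by
    rw [← Submodule.finrank_map_subtype_eq, hkermap,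
      ← (Submodule.equivMapOfInjective (LinearMap.mulLeft K h) (mul_right_injective₀ hh0)
        (homogeneousSubmodule (Fin (m + 1)) K n)).finrank_eq, finrank_homogeneousSubmodule]
  have : Module.Finite K (homogeneousSubmodule (Fin (m + 1)) K (e + n)) :=
    Module.Finite.iff_fg.2 (homogeneousSubmodule_fg _ _ _)
  have hrk := LinearMap.finrank_range_add_finrank_ker T
  rw [hker, finrank_homogeneousSubmodule, ← hrange] at hrk
  exact hrk

/-- Telescoping Pascal's rule writes the Hilbert function in degree `e + n` as a sum of `e` binomial
coefficients, each asymptotic to `n ^ m / m!`; hence the degree is `e`. -/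
theorem choose_add_eq_sum (m e n : ℕ) :
    (e + n + (m + 1)).choose (m + 1) =
      ∑ i ∈ Finset.range e, (n + (i + 1 + m)).choose m + (n + (m + 1)).choose (m + 1) := by
  induction e with
  | zero => simp
  | succ e ih =>
    rw [Finset.sum_range_succ]
    have h1 := Nat.choose_succ_succ (e + n + (m + 1)) m
    rw [show e + 1 + n + (m + 1) = (e + n + (m + 1)).succ by omega, h1, ih,
      show n + (e + 1 + m) = e + n + (m + 1) by omega]
    ring

theorem tendsto_factorial_mul_choose_div (m a : ℕ) :
    Filter.Tendsto (fun n : ℕ => (m.factorial * ((n + a).choose m : ℝ)) / (n : ℝ) ^ m)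
      Filter.atTop (nhds 1) := by
  have h1 := (isEquivalent_choose m).comp_tendsto (Filter.tendsto_add_atTop_nat a)
  have h2 : Filter.Tendsto (fun n : ℕ => (((n + a : ℕ) : ℝ) / n) ^ m) Filter.atTop (nhds 1) := by
    have h3 : Filter.Tendsto (fun n : ℕ => 1 + (a : ℝ) / n) Filter.atTop (nhds (1 + 0)) :=
      tendsto_const_nhds.add (tendsto_const_div_atTop_nhds_zero_nat (a : ℝ))
    have h4 := h3.pow m
    rw [add_zero, one_pow] at h4
    refine h4.congr' ?_
    filter_upwards [Filter.eventually_gt_atTop 0] with n hn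
    have : (n : ℝ) ≠ 0 := by exact_mod_cast hn.ne'
    congr 1
    push_cast
    field_simp
  have hm : (m.factorial : ℝ) ≠ 0 := by exact_mod_cast m.factorial_ne_zero
  have h5 := (Asymptotics.isEquivalent_iff_tendsto_one (by
    filter_upwards [Filter.eventually_gt_atTop 0] with n hn
    have : ((n + a : ℕ) : ℝ) ≠ 0 := by exact_mod_cast (by omega)
    exact div_ne_zero (pow_ne_zero _ this) hm)).1 h1
  have h6 := h5.mul h2
  rw [one_mul] at h6
  refine h6.congr' ?_
  filter_upwards [Filter.eventually_gt_atTop 0] with n hn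
  have hn0 : (n : ℝ) ≠ 0 := by exact_mod_cast hn.ne'
  have : ((n + a : ℕ) : ℝ) ≠ 0 := by exact_mod_cast (by omega)
  simp only [Pi.div_apply, Function.comp_apply, div_pow]
  field_simp

theorem hasDegree_of_vanishingIdeal_eq {head : Fin (m + 2) → ι} (hhead : Function.Injective head)
    {V : Set (Projectivization K (ι → K))} {h : MvPolynomial (Fin (m + 2)) K} (hh0 : h ≠ 0)
    {e : ℕ} (hh : h.IsHomogeneous e)
    (hV : vanishingIdeal V = (Ideal.span {h}).comap (killCompl hhead))
    (hdim : dim V = (m : WithBot ℕ∞)) : HasDegree V e := by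
  refine ⟨m, hdim, ?_⟩
  have hsum : Filter.Tendsto (fun n : ℕ => ∑ i ∈ Finset.range e,
      (m.factorial * ((n + (i + 1 + m)).choose m : ℝ)) / (n : ℝ) ^ m)
      Filter.atTop (nhds (∑ i ∈ Finset.range e, 1)) :=
    tendsto_finsetSum _ fun i _ => tendsto_factorial_mul_choose_div m _
  rw [Finset.sum_const, Finset.card_range, nsmul_eq_mul, mul_one] at hsum
  have hscale : Filter.Tendsto (fun n : ℕ => ((n : ℝ) / (n + e : ℕ)) ^ m)
      Filter.atTop (nhds 1) := by
    have h4 := (tendsto_natCast_div_add_atTop (e : ℝ)).pow m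
    rw [one_pow] at h4
    simpa using h4
  have hprod := hsum.mul hscale
  rw [mul_one] at hprod
  rw [← Filter.tendsto_add_atTop_iff_nat e]
  refine hprod.congr' ?_
  filter_upwards [Filter.eventually_gt_atTop 0] with n hn
  have hn0 : (n : ℝ) ≠ 0 := by exact_mod_cast hn.ne'
  have hne0 : ((n + e : ℕ) : ℝ) ≠ 0 := by exact_mod_cast (by omega)
  have h1 := hilbertFunction_add_choose hhead hh0 hh hV n
  rw [choose_add_eq_sum, Nat.add_right_cancel_iff] at h1
  rw [add_comm n e, h1, ← Finset.sum_div, ← Finset.mul_sum]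
  rw [add_comm n e] at hne0
  push_cast at hne0 ⊢
  rw [div_pow]
  field_simp

end Degree

/-! ### Irreducible components of the determinantal locus. -/

section Component

variable {K : Type*} [Field K] [Infinite K] {N n : ℕ}

theorem isIrredComponent_of_vanishingIdeal_eq {head : Fin (n + 1) → Fin (N + 1)}
    (hhead : Function.Injective head) {Y V : Set (Projectivization K (Fin (N + 1) → K))}
    (hY : IsClosed Y) {h F : MvPolynomial (Fin (n + 1)) K} (hh : Prime h)
    (hYh : vanishingIdeal Y = (Ideal.span {h}).comap (killCompl hhead))
    (hF0 : F ≠ 0) (hdvd : h ∣ F)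
    (hV : V = zeroLocus ({rename head F} ∪ {G | ∃ i, i ∉ Set.range head ∧ G = X i})) :
    IsIrredComponent Y V := by
  have hprime : (vanishingIdeal Y).IsPrime := by
    rw [hYh]
    exact ((Ideal.span_singleton_prime hh.ne_zero).2 hh).comap _
  refine ⟨⟨isIrreducible_of_isPrime_vanishingIdeal hprime, ?_⟩, ?_⟩
  · rw [hV]
    rintro p hp G (hG | ⟨i, hi, rfl⟩)
    · rw [Set.mem_singleton_iff] at hG
      subst hG
      have : rename head F ∈ vanishingIdeal Y := by
        rw [hYh, Ideal.mem_comap, killCompl_rename_app]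
        exact Ideal.mem_span_singleton.2 hdvd
      exact this p hp
    · have : (X i : MvPolynomial (Fin (N + 1)) K) ∈ vanishingIdeal Y := by
        rw [hYh, Ideal.mem_comap, killCompl, aeval_X, dif_neg hi]
        exact zero_mem _
      exact this p hp
  · rintro S ⟨hS, hSV⟩ hYS
    refine hY.subset_of_vanishingIdeal_le ?_
    have hSprime := hS.isPrime_vanishingIdeal
    have hSX : ∀ i, i ∉ Set.range head →
        (X i : MvPolynomial (Fin (N + 1)) K) ∈ vanishingIdeal S := by
      intro i hi p hp
      have := hSV hp
      rw [hV] at this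
      exact this _ (Or.inr ⟨i, hi, rfl⟩)
    have hSF : rename head F ∈ vanishingIdeal S := by
      intro p hp
      have := hSV hp
      rw [hV] at this
      exact this _ (Or.inl rfl)
    -- Write `F = h ^ k * q` with `h ∤ q`. The prime ideal `I(S)` contains `h` or `q`, and `q` is
    -- excluded because `I(S) ⊆ I(Y)`.
    obtain ⟨q, hq, hFq⟩ := (FiniteMultiplicity.of_not_isUnit hh.not_isUnit
      hF0).exists_eq_pow_mul_and_not_dvd
    have hSh : rename head h ∈ vanishingIdeal S := by
      rw [hq, map_mul, map_pow] at hSF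
      rcases hSprime.mem_or_mem hSF with h1 | h1
      · exact hSprime.mem_of_pow_mem _ h1
      · have h2 := vanishingIdeal_anti hYS h1
        rw [hYh, Ideal.mem_comap, killCompl_rename_app, Ideal.mem_span_singleton] at h2
        exact absurd h2 hFq
    rw [eq_comap_killCompl hhead hSX, hYh]
    exact Ideal.comap_mono ((Ideal.span_singleton_le_iff_mem _).2 hSh)

end Component

/-! ### Translation of the canonical form, and conclusion. -/

section CanonicalForm

variable {K : Type*} [Field K] {N σ : ℕ}

theorem headIndex_injective (h : 2 * σ ≤ N) : Function.Injective (headIndex h) := fun a b hab => by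
  simpa [headIndex, Fin.ext_iff] using hab

theorem tailIndex_injective (h : 2 * σ ≤ N) : Function.Injective (tailIndex h) := fun a b hab => by
  simpa [tailIndex, Fin.ext_iff] using hab

theorem notMem_range_headIndex_iff (h : 2 * σ ≤ N) {i : Fin (N + 1)} :
    i ∉ Set.range (headIndex h) ↔ σ < (i : ℕ) := by
  constructor
  · intro hi
    by_contra hlt
    exact hi ⟨⟨i, by omega⟩, rfl⟩
  · rintro hi ⟨j, rfl⟩
    have := j.2
    simp only [headIndex] at hi
    omega

theorem pderiv_headIndex_of_mem_supported (h : 2 * σ ≤ N) (j : Fin (σ + 1))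
    {F : MvPolynomial (Fin (N + 1)) K} {s : Set (Fin (N + 1))} (hF : F ∈ supported K s)
    (hs : ∀ i ∈ s, σ < (i : ℕ)) : pderiv (headIndex h j) F = 0 := by
  refine pderiv_eq_zero_of_notMem_vars fun hmem => ?_
  have h1 := hs _ (mem_supported.1 hF hmem)
  have := j.2
  simp only [headIndex] at h1
  omega

theorem tailIndex_gt (h : 2 * σ ≤ N) : ∀ i ∈ Set.range (tailIndex h), σ < (i : ℕ) := by
  rintro _ ⟨k, rfl⟩
  have := k.2
  simp only [tailIndex]
  omega

variable {f D : MvPolynomial (Fin (N + 1)) K} {C : Fin (σ + 1) → MvPolynomial (Fin (N + 1)) K}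

theorem pderiv_headIndex_of_isCanonicalForm {h : 2 * σ ≤ N} (hcan : IsCanonicalForm h f C D)
    (j : Fin (σ + 1)) : pderiv (headIndex h j) f = C j := by
  classical
  rw [hcan.eq, map_add, pderiv_headIndex_of_mem_supported h j hcan.cubic_vars (fun _ hi => hi),
    add_zero, map_sum, Finset.sum_eq_single j]
  · rw [Derivation.leibniz, pderiv_headIndex_of_mem_supported h j (hcan.quadratic_vars j)
      (tailIndex_gt h), pderiv_X_self]
    simp
  · intro i _ hij
    rw [Derivation.leibniz, pderiv_headIndex_of_mem_supported h j (hcan.quadratic_vars i)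
      (tailIndex_gt h), pderiv_X_of_ne fun hx => hij (headIndex_injective h hx)]
    simp
  · simp

theorem exists_quadratic_of_isCanonicalForm {h : 2 * σ ≤ N} (hcan : IsCanonicalForm h f C D) :
    ∃ c : Fin (σ + 1) → MvPolynomial (Fin σ) K, (∀ j, (c j).IsHomogeneous 2) ∧
      ∀ j, C j = rename (tailIndex h) (c j) := by
  have hex : ∀ j, ∃ c, rename (tailIndex h) c = C j := fun j =>
    exists_rename_eq_of_vars_subset_range (C j) _ (tailIndex_injective h)
      (mem_supported.1 (hcan.quadratic_vars j))
  choose c hc using hex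
  refine ⟨c, fun j => ?_, fun j => (hc j).symm⟩
  rw [← IsHomogeneous.rename_isHomogeneous_iff (tailIndex_injective h), hc]
  exact hcan.quadratic j

theorem detMatrix_eq_map {h : 2 * σ ≤ N} {c : Fin (σ + 1) → MvPolynomial (Fin σ) K}
    (hc : ∀ j, (c j).IsHomogeneous 2) (hC : ∀ j, C j = rename (tailIndex h) (c j)) :
    detMatrix h C = (pencilMatrix c).map (rename (headIndex h)) := by
  ext1 k i
  simp only [detMatrix, pencilMatrix, Matrix.of_apply, Matrix.map_apply, map_sum, map_mul, rename_X,
    rename_C, hC, pderiv_rename (tailIndex_injective h), ← C_secondDerivative hc]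

end CanonicalForm

theorem mainTheorem10 {K : Type*} [Field K] [IsAlgClosed K] [CharZero K] {N σ : ℕ}
    (h : 2 * σ ≤ N) (f : MvPolynomial (Fin (N + 1)) K)
    (C : Fin (σ + 1) → MvPolynomial (Fin (N + 1)) K) (D : MvPolynomial (Fin (N + 1)) K)
    (hf : Perazzo.IsSpecialPerazzoCubic f)
    (hcodim : Perazzo.dim (Perazzo.polarImage f) + 1 = (N : WithBot ℕ∞))
    (hσ : Perazzo.dim (Perazzo.dualVariety (Perazzo.polarImage f)) + 1 = (σ : WithBot ℕ∞))
    (hcan : Perazzo.IsCanonicalForm h f C D) :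
    (∀ k i, (Perazzo.detMatrix h C k i).IsHomogeneous 1 ∧
      Perazzo.detMatrix h C k i ∈
        MvPolynomial.supported K (Set.range (Perazzo.headIndex h))) ∧
    (Perazzo.detMatrix h C).det ≠ 0 ∧
    Perazzo.IsIrredComponent (Perazzo.dualVariety (Perazzo.polarImage f))
      (Perazzo.determinantalLocus h C) ∧
    ∃ e : ℕ, Perazzo.HasDegree (Perazzo.dualVariety (Perazzo.polarImage f)) e ∧ e ≤ σ := by
  have hinf : Infinite K := IsAlgClosed.instInfinite
  -- A dimension is `⊥` or at least `0`, so `σ = m + 1` is positive and `Z^*` has dimension `m`.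
  obtain ⟨m, rfl, hdim⟩ := exists_nat_of_add_one_eq hσ
  obtain ⟨c, hc, hC⟩ := exists_quadratic_of_isCanonicalForm hcan
  have hhead := headIndex_injective h
  have hA := detMatrix_eq_map hc hC
  have hdet : (detMatrix h C).det = rename (headIndex h) (pencilMatrix c).det := by
    rw [hA, AlgHom.map_det]; rfl
  obtain ⟨g, hg, hI, hne, hdvd⟩ := exists_equation_dualVariety (Nat.succ_ne_zero m) hf.1
    hf.2.1.ne_zero hhead (tailIndex_injective h) hc
    (fun j => (pderiv_headIndex_of_isCanonicalForm hcan j).trans (hC j)) hcodim hσ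
  refine ⟨fun k i => ⟨?_, ?_⟩, ?_, ?_, g.totalDegree, ?_, ?_⟩
  · rw [hA, Matrix.map_apply]
    exact (pencilMatrix_isHomogeneous k i).rename_isHomogeneous
  · rw [hA, Matrix.map_apply]
    exact mem_supported.2 ((Finset.coe_subset.2 (vars_rename _ _)).trans (by simp))
  · rw [hdet]
    exact fun h0 => hne (rename_injective _ hhead (by rw [h0, map_zero]))
  · refine isIrredComponent_of_vanishingIdeal_eq hhead isClosed_closure hg hI hne hdvd ?_
    rw [determinantalLocus, hdet]
    congr 2
    ext G
    simp only [equationsM, notMem_range_headIndex_iff]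
  · refine hasDegree_of_vanishingIdeal_eq hhead hg.ne_zero ?_ hI hdim
    refine isHomogeneous_of_span_singleton (I := (vanishingIdeal
      (dualVariety (polarImage f))).comap (rename (R := K) (headIndex h))) (fun F hF n => ?_)
      hg.ne_zero ?_
    · rw [Ideal.mem_comap, rename_homogeneousComponent]
      exact homogeneousComponent_mem_vanishingIdeal hF n
    · ext r
      rw [hI, Ideal.mem_comap, Ideal.mem_comap, killCompl_rename_app]
  · obtain ⟨q, hq⟩ := hdvd
    have hq0 : q ≠ 0 := by rintro rfl; exact hne (by rw [hq, mul_zero])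
    have h1 := (det_pencilMatrix_isHomogeneous (c := c)).totalDegree hne
    rw [hq, totalDegree_mul_of_isDomain hg.ne_zero hq0] at h1
    omega
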